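/- Let $a,b>0$, $c=\sqrt{a^2+b^2}$, let $\Gamma$ be the hyperbola $x^2/a^2-y^2/b^2=1$ in $\mathbb C$ ($z=x+iy$), and let $\Omega_0$, $\Omega_+$ be the components of $\mathbb C\setminus\Gamma$ containing $0$ and $c$, respectively. Put $\mathbb U=\{\operatorname{Im}\zeta>0\}$, $$f(\zeta)=\tfrac12\big((a-ib)\zeta+(a+ib)\zeta^{-1}\big),\qquad f^*(\zeta)=\overline{f(\bar\zeta)}.$$ 1. $f$ maps $\mathbb R\setminus\{0\}$ bijectively onto $\Gamma$, and $f$ maps $\mathbb U$ onto the partly double-sheeted domain $\Omega=2\cdot\Omega_++1\cdot\Omega_0$: every $w\in\mathbb C\setminus\Gamma$ has, counted with multiplicity, $2$ preimages in $\mathbb U$ if $w\in\Omega_+$, one if $w\in\Omega_0$, and none otherwise. 2. The roots of $1+ff^*=0$ in $\mathbb U$ are exactly the points $\zeta_1,\zeta_2\in\mathbb U$ given by $$c\,\zeta_1=\sqrt{-(2+a^2-b^2)+2\sqrt{(1+a^2)(1-b^2)}},\qquad c\,\zeta_2=\sqrt{-(2+a^2-b^2)-2\sqrt{(1+a^2)(1-b^2)}},$$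 where the inner square root is nonnegative if $b\le1$ and equals $i\sqrt{(a^2+1)(b^2-1)}$ if $b>1$, and the outer square roots are the ones with positive imaginary part. If $b<1$, both are purely imaginary and $0<\operatorname{Im}\zeta_1<\operatorname{Im}\zeta_2$; if $b>1$, $\zeta_1$ lies in the first and $\zeta_2$ in the second open quadrant; if $b=1$, $\zeta_1=\zeta_2=i$, which is a double root. 3. Let $h$ be holomorphic in $\mathbb U$ and integrable with respect to the pulled-back spherical measure $$\frac{1}{2\pi i}\frac{d\bar f\wedge df}{(1+|f|^2)^2}=\frac{|f'(\zeta)|^2}{\pi(1+|f(\zeta)|^2)^2}\,d\xi\,d\eta\qquad(\zeta=\xi+i\eta).$$ Then $$\frac1{2\pi i}\int_{\mathbb U}h\,\frac{d\bar f\wedge df}{(1+|f|^2)^2}=\tfrac12\big(h(\zeta_1)+h(\zeta_2)\big)-\tfrac12\,\frac{i\,ab}{\sqrt{(1+a^2)(1-b^2)}}\big(h(\zeta_1)-h(\zeta_2)\big)\quad\text{if } b<1,$$ $$\frac1{2\pi i}\int_{\mathbb U}h\,\frac{d\bar f\wedge df}{(1+|f|^2)^2}=\tfrac12\big(h(\zeta_1)+h(\zeta_2)\big)-\tfrac12\,\frac{ab}{\sqrt{(a^2+1)(b^2-1)}}\big(h(\zeta_1)-h(\zeta_2)\big)\quad\text{if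 } b>1,$$ $$\frac1{2\pi i}\int_{\mathbb U}h\,\frac{d\bar f\wedge df}{(1+|f|^2)^2}=h(i)-\frac{a}{1+a^2}\,h'(i)\quad\text{if } b=1.$$ -/

import Mathlib

open Set MeasureTheory
open scoped ComplexConjugate

noncomputable section

/-- The open upper half-plane, as a subset of `ℂ`. -/
def upperHalf : Set ℂ := {ζ | 0 < ζ.im}

/-- The hyperbola `x²/a² - y²/b² = 1` in the complex plane, `z = x + iy`. -/
def hyperbola (a b : ℝ) : Set ℂ := {z | z.re ^ 2 / a ^ 2 - z.im ^ 2 / b ^ 2 = 1}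

/-- Half the distance between the foci, `c = √(a² + b²)`; the foci are `±c`. -/
def focalRadius (a b : ℝ) : ℝ := Real.sqrt (a ^ 2 + b ^ 2)

/-- `Ω₀`: the component of the complement of the hyperbola that contains `0`. -/
def hyperbolaMid (a b : ℝ) : Set ℂ := connectedComponentIn (hyperbola a b)ᶜ 0

/-- `Ω₊`: the component of the complement of the hyperbola that contains the focus `+c`. -/
def hyperbolaRight (a b : ℝ) : Set ℂ :=
  connectedComponentIn (hyperbola a b)ᶜ (focalRadius a b : ℂ)

/-- The rational function `f(ζ) = ½((a - ib) ζ + (a + ib) ζ⁻¹)`. -/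
def hypMap (a b : ℝ) (ζ : ℂ) : ℂ :=
  (1 / 2) * (((a : ℂ) - Complex.I * b) * ζ + ((a : ℂ) + Complex.I * b) * ζ⁻¹)

/-- The holomorphic reflection `f^*(ζ) = conj (f (conj ζ))` of `f` with respect to the involution
`J(ζ) = conj ζ`, whose fixed point set is the real line. -/
def reflected (f : ℂ → ℂ) (ζ : ℂ) : ℂ := conj (f (conj ζ))

/-- The number of points `ζ` of `D` with `f ζ = w`, counted with multiplicity: the number of sheets
over `w` of the multi-sheeted domain `f(D)`. -/
def sheetNumber (f : ℂ → ℂ) (D : Set ℂ) (w : ℂ) : ℕ :=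
  ∑ᶠ ζ ∈ {ζ | ζ ∈ D ∧ f ζ = w}, analyticOrderNatAt (fun η => f η - w) ζ

/-- The pull-back by `f` to `D` of the spherical area measure, normalized to total mass one on the
sphere. Since `df̄ ∧ df = |f'|² dζ̄ ∧ dζ = 2i |f'|² dx ∧ dy` for holomorphic `f`, the form
`(1 / 2πi) df̄ ∧ df / (1 + |f|²)²` has the density `|f'|² / (π (1 + |f|²)²)` with respect to Lebesgue
measure in the `ζ`-plane. -/
def sphericalPullback (f : ℂ → ℂ) (D : Set ℂ) : Measure ℂ :=
  (volume.restrict D).withDensity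
    (fun ζ => ENNReal.ofReal (‖deriv f ζ‖ ^ 2 / (Real.pi * (1 + ‖f ζ‖ ^ 2) ^ 2)))

/-- `√((1 + a²)(1 - b²))`, the principal complex square root: a nonnegative real number if `b ≤ 1`,
and `i √((a² + 1)(b² - 1))` if `b > 1`. -/
def hypRoot (a b : ℝ) : ℂ := (((1 + a ^ 2) * (1 - b ^ 2) : ℝ) : ℂ) ^ (1 / 2 : ℂ)

/-- The square root with positive imaginary part of a complex number outside `[0, ∞)`. -/
def upperSqrt (w : ℂ) : ℂ := Complex.I * (-w) ^ (1 / 2 : ℂ)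

/-- The node `ζ₁`: `c ζ₁ = √(-(2 + a² - b²) + 2 √((1 + a²)(1 - b²)))`, in the upper half-plane. -/
def hypNode₁ (a b : ℝ) : ℂ :=
  upperSqrt (-(2 + (a : ℂ) ^ 2 - (b : ℂ) ^ 2) + 2 * hypRoot a b) / (focalRadius a b : ℂ)

/-- The node `ζ₂`: `c ζ₂ = √(-(2 + a² - b²) - 2 √((1 + a²)(1 - b²)))`, in the upper half-plane. -/
def hypNode₂ (a b : ℝ) : ℂ :=
  upperSqrt (-(2 + (a : ℂ) ^ 2 - (b : ℂ) ^ 2) - 2 * hypRoot a b) / (focalRadius a b : ℂ)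

end

/-! Sheets. The equation f(ζ) = w is a quadratic with leading coefficient a - ib, and its roots ζ₁,
ζ₂ satisfy Vieta's relations. Separating real and imaginary parts shows that the defining form of
the hyperbola, minus 1, is at w a positive multiple of Im ζ₁ · Im ζ₂, while Im ζ₁ + Im ζ₂ is a
positive multiple of b Re w + a Im w (`hypForm_sub_one_eq`). The signs of the two imaginary parts,
and hence the sheet number, can be read off.

Nodes. 4ζ²(1 + ff*) is a self-reciprocal quadratic in ζ² whose roots are the squares of the nodes
(`one_add_hypMap_mul_reflected`).

Quadrature. The density h|f'|²/(1+|f|²)² is the ∂̄-derivative of h f' f̄/(1+|f|²). On the real line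
f̄ = f*, so Stokes' formula leads to a boundary integral of the meromorphic function h f'f*/(1+ff*),
and the residues at the nodes give the formulas. Since h is only integrable, it need not have
boundary values, and f has poles on the boundary. Therefore everything is moved to the unit disc,
Green's formula is applied on circles of radius r < 1, and f̄ is replaced by f* there. The error is
at most C(1-r) times the circle integral of |h| against the density, uniformly up to the poles
(`exists_discError_bound`). If the error did not tend to 0, these circle integrals would dominate a
multiple of 1/(1-r), contradicting integrability (`setIntegral_ball_eq_of_bound`). -/

/-! ### The real line and the hyperbola -/

theorem hypMap_re_im_ofReal (a b t : ℝ) :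
    (hypMap a b t).re = a * (t + t⁻¹) / 2 ∧ (hypMap a b t).im = -(b * (t - t⁻¹) / 2) := by
  have h : hypMap a b t = ((a * (t + t⁻¹) / 2 : ℝ) : ℂ) + ((-(b * (t - t⁻¹) / 2) : ℝ) : ℂ)
      * Complex.I := by
    unfold hypMap; push_cast; ring
  rw [h]
  constructor <;> simp

theorem hypMap_bijOn (a b : ℝ) (ha : 0 < a) (hb : 0 < b) :
    BijOn (hypMap a b) {ζ : ℂ | ζ.im = 0 ∧ ζ ≠ 0} (hyperbola a b) := by
  have key : ∀ ζ : ℂ, ζ.im = 0 → ∃ t : ℝ, ζ = t := fun ζ h => ⟨ζ.re, by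
    apply Complex.ext <;> simp [h]⟩
  refine ⟨?_, ?_, ?_⟩
  · rintro ζ ⟨h1, h2⟩
    obtain ⟨t, rfl⟩ := key ζ h1
    have ht : t ≠ 0 := by exact_mod_cast h2
    obtain ⟨h3, h4⟩ := hypMap_re_im_ofReal a b t
    simp only [hyperbola, mem_ofPred_eq, h3, h4]
    field_simp
    ring
  · rintro ζ ⟨h1, h2⟩ ξ ⟨h5, h6⟩ h
    obtain ⟨t, rfl⟩ := key ζ h1
    obtain ⟨s, rfl⟩ := key ξ h5
    obtain ⟨h3, h4⟩ := hypMap_re_im_ofReal a b t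
    obtain ⟨h7, h8⟩ := hypMap_re_im_ofReal a b s
    rw [h] at h3 h4
    have e1 : a * (t + t⁻¹) = a * (s + s⁻¹) := by linarith
    have e2 : b * (t - t⁻¹) = b * (s - s⁻¹) := by linarith
    have e1 := mul_left_cancel₀ ha.ne' e1
    have e2 := mul_left_cancel₀ hb.ne' e2
    have : t = s := by linarith
    rw [this]
  · intro z hz
    simp only [hyperbola, mem_ofPred_eq] at hz
    set x := z.re / a with hx
    set y := z.im / b with hy
    have h1 : (x - y) * (x + y) = 1 := by
      rw [← hz, hx, hy]; ring
    have h0 : x - y ≠ 0 := left_ne_zero_of_mul_eq_one h1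
    -- If z = f(t), then x = (t + 1/t)/2 and y = -(t - 1/t)/2, so t = x - y and 1/t = x + y.
    refine ⟨((x - y : ℝ) : ℂ), ⟨by simp, by exact_mod_cast h0⟩, ?_⟩
    obtain ⟨h3, h4⟩ := hypMap_re_im_ofReal a b (x - y)
    rw [inv_eq_of_mul_eq_one_right h1] at h3 h4
    apply Complex.ext
    · rw [h3, hx]; field_simp; ring
    · rw [h4, hy]; field_simp; ring

/-! ### The components of the complement of the hyperbola -/

theorem connectedComponentIn_eq_of_isOpen {X : Type*} [TopologicalSpace X] {S V W : Set X} {x : X}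
    (hV : IsOpen V) (hW : IsOpen W) (hVW : Disjoint V W) (hS : S = V ∪ W) (hx : x ∈ V)
    (hc : IsPreconnected V) : connectedComponentIn S x = V := by
  apply Subset.antisymm
  · refine isPreconnected_connectedComponentIn.subset_left_of_subset_union hV hW hVW
      (hS ▸ connectedComponentIn_subset S x) ⟨x, mem_connectedComponentIn ?_, hx⟩
    rw [hS]; exact Or.inl hx
  · exact hc.subset_connectedComponentIn hx (by rw [hS]; exact subset_union_left)

/-- The quadratic form defining the hyperbola. -/
noncomputable def hypForm (a b : ℝ) (z : ℂ) : ℝ := z.re ^ 2 / a ^ 2 - z.im ^ 2 / b ^ 2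

theorem continuous_hypForm (a b : ℝ) : Continuous (hypForm a b) := by
  unfold hypForm
  exact ((Complex.continuous_re.pow 2).div_const _).sub ((Complex.continuous_im.pow 2).div_const _)

theorem hyperbolaMid_eq (a b : ℝ) : hyperbolaMid a b = {z | hypForm a b z < 1} := by
  have hc := continuous_hypForm a b
  refine connectedComponentIn_eq_of_isOpen (W := {z | 1 < hypForm a b z})
    (isOpen_lt hc continuous_const) (isOpen_lt continuous_const hc) ?_ ?_ ?_ ?_
  · rw [Set.disjoint_left]
    intro z h1 h2
    exact lt_asymm (show hypForm a b z < 1 from h1) h2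
  · ext z
    simp only [hyperbola, hypForm, mem_compl_iff, mem_ofPred_eq, mem_union]
    exact lt_or_lt_iff_ne.symm
  · simp [hypForm]
  -- The form is homogeneous of degree 2, so shrinking towards 0 cannot raise its value past 1.
  · have hs : StarConvex ℝ (0 : ℂ) {z | hypForm a b z < 1} := by
      rw [starConvex_zero_iff]
      intro z hz t ht0 ht1
      simp only [mem_ofPred_eq] at hz ⊢
      have : hypForm a b (t • z) = t ^ 2 * hypForm a b z := by
        simp only [hypForm, Complex.real_smul, Complex.re_ofReal_mul, Complex.im_ofReal_mul]; ring
      rw [this]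
      have h2 : t ^ 2 ≤ 1 := pow_le_one₀ ht0 ht1
      rcases le_or_gt (hypForm a b z) 0 with h | h
      · nlinarith [sq_nonneg t]
      · nlinarith [sq_nonneg t]
    exact (hs.isPathConnected (by simp [hypForm])).isConnected.isPreconnected


/-- The region is the strict epigraph x/a > |1 + iy/b| of a convex function, so the triangle
inequality suffices. -/
theorem convex_right {a : ℝ} (b : ℝ) (ha : 0 < a) :
    Convex ℝ {z : ℂ | 1 < hypForm a b z ∧ 0 < z.re} := by
  have e : {z : ℂ | 1 < hypForm a b z ∧ 0 < z.re} =
      {z : ℂ | ‖(⟨1, z.im / b⟩ : ℂ)‖ < z.re / a} := by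
    ext z
    simp only [mem_ofPred_eq, hypForm]
    constructor
    · rintro ⟨h1, h2⟩
      rw [← abs_of_pos (div_pos h2 ha), ← sq_lt_sq₀ (norm_nonneg _) (abs_nonneg _), sq_abs,
        ← Complex.normSq_eq_norm_sq, Complex.normSq_mk, div_pow]
      have : 1 * 1 + z.im / b * (z.im / b) = 1 + z.im ^ 2 / b ^ 2 := by ring
      linarith
    · intro h
      have h0 : 0 < z.re / a := (norm_nonneg _).trans_lt h
      refine ⟨?_, by simpa [ha] using mul_pos h0 ha |>.trans_eq (div_mul_cancel₀ _ ha.ne')⟩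
      rw [← sq_lt_sq₀ (norm_nonneg _) h0.le,
        ← Complex.normSq_eq_norm_sq, Complex.normSq_mk, div_pow] at h
      have : 1 * 1 + z.im / b * (z.im / b) = 1 + z.im ^ 2 / b ^ 2 := by ring
      linarith
  rw [e]
  intro z hz w hw s t hs ht hst
  simp only [mem_ofPred_eq] at hz hw ⊢
  have h1 : (⟨1, (s • z + t • w).im / b⟩ : ℂ) = s • (⟨1, z.im / b⟩ : ℂ) + t • ⟨1, w.im / b⟩ := by
    apply Complex.ext
    · simp [hst]
    · simp; ring
  have h2 : (s • z + t • w).re / a = s * (z.re / a) + t * (w.re / a) := by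
    simp; ring
  rw [h1, h2]
  refine (norm_add_le _ _).trans_lt ?_
  rw [norm_smul, norm_smul, Real.norm_of_nonneg hs, Real.norm_of_nonneg ht]
  rcases hs.eq_or_lt with rfl | hs'
  · have : t = 1 := by linarith
    subst this; simpa using hw
  · have := mul_lt_mul_of_pos_left hz hs'
    have := mul_le_mul_of_nonneg_left hw.le ht
    linarith

theorem hyperbolaRight_eq {a b : ℝ} (ha : 0 < a) (hb : 0 < b) :
    hyperbolaRight a b = {z | 1 < hypForm a b z ∧ 0 < z.re} := by
  have hc := continuous_hypForm a b
  refine connectedComponentIn_eq_of_isOpen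
    (W := {z | hypForm a b z < 1} ∪ {z | 1 < hypForm a b z ∧ z.re < 0})
    ((isOpen_lt continuous_const hc).inter (isOpen_lt continuous_const Complex.continuous_re))
    ((isOpen_lt hc continuous_const).union
      ((isOpen_lt continuous_const hc).inter (isOpen_lt Complex.continuous_re continuous_const)))
    ?_ ?_ ?_ (convex_right b ha).isPreconnected
  · rw [Set.disjoint_left]
    rintro z ⟨h1, h2⟩ (h3 | ⟨-, h3⟩)
    · exact lt_asymm h1 h3
    · exact lt_asymm h2 h3
  · ext z
    simp only [hyperbola, mem_compl_iff, mem_ofPred_eq, mem_union]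
    change ¬ hypForm a b z = 1 ↔ _
    -- The form is nonpositive on the imaginary axis, so that axis separates the two outer regions.
    have h0 : 1 < hypForm a b z → z.re ≠ 0 := by
      intro h h'
      rw [hypForm, h'] at h
      have : 0 ≤ z.im ^ 2 / b ^ 2 := by positivity
      norm_num at h
      linarith
    rcases lt_trichotomy (hypForm a b z) 1 with h | h | h
    · simp [h, h.ne]
    · simp [h]
    · have := lt_or_gt_of_ne (h0 h)
      simp only [h, h.ne', not_false_eq_true, true_and, true_iff]
      tauto
  · have h1 : (0 : ℝ) < a ^ 2 + b ^ 2 := by positivity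
    refine ⟨?_, ?_⟩
    · simp only [hypForm, focalRadius, Complex.ofReal_re, Complex.ofReal_im]
      rw [Real.sq_sqrt h1.le, add_div, div_self (by positivity)]
      have : 0 < b ^ 2 / a ^ 2 := by positivity
      simpa using this
    · simpa [focalRadius] using h1

/-! ### Counting sheets -/

theorem sub_I_mul_ne_zero {a : ℝ} (b : ℝ) (ha : 0 < a) : ((a : ℂ) - Complex.I * b) ≠ 0 := by
  intro h
  have := congrArg Complex.re h
  simp at this
  exact ha.ne' this

/-- The two solutions, with multiplicity, of `hypMap a b ζ = w`. -/
theorem exists_hypMap_roots {a : ℝ} (b : ℝ) (ha : 0 < a) (w : ℂ) : ∃ ζ₁ ζ₂ : ℂ,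
    ((a : ℂ) - Complex.I * b) * (ζ₁ + ζ₂) = 2 * w ∧
    ((a : ℂ) - Complex.I * b) * (ζ₁ * ζ₂) = (a : ℂ) + Complex.I * b := by
  -- s² is a quarter of the discriminant of (a - ib)ζ² - 2wζ + (a + ib).
  obtain ⟨s, hs⟩ := IsAlgClosed.exists_pow_nat_eq
    (w ^ 2 - ((a : ℂ) - Complex.I * b) * ((a : ℂ) + Complex.I * b)) (n := 2) (by norm_num)
  have h := sub_I_mul_ne_zero b ha
  refine ⟨(w + s) / ((a : ℂ) - Complex.I * b), (w - s) / ((a : ℂ) - Complex.I * b), ?_, ?_⟩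
  · field_simp; ring
  · field_simp; linear_combination -hs

theorem hypMap_sub_eq {a b : ℝ} {w ζ₁ ζ₂ ζ : ℂ}
    (h1 : ((a : ℂ) - Complex.I * b) * (ζ₁ + ζ₂) = 2 * w)
    (h2 : ((a : ℂ) - Complex.I * b) * (ζ₁ * ζ₂) = (a : ℂ) + Complex.I * b) (hζ : ζ ≠ 0) :
    hypMap a b ζ - w = (ζ - ζ₁) * ((ζ - ζ₂) * (((a : ℂ) - Complex.I * b) / (2 * ζ))) := by
  unfold hypMap
  rw [← h2]
  field_simp
  linear_combination ζ * h1

theorem analyticOrderAt_eq_of_eventuallyEq {f g : ℂ → ℂ} {z : ℂ} {n : ℕ}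
    (hg' : ∀ᶠ x in nhds z, DifferentiableAt ℂ g x) (h0 : g z ≠ 0)
    (h : ∀ᶠ x in nhds z, f x = (x - z) ^ n * g x) : analyticOrderAt f z = n := by
  have ga : AnalyticAt ℂ g z := Complex.analyticAt_iff_eventually_differentiableAt.2 hg'
  have fa : AnalyticAt ℂ f z := by
    have : AnalyticAt ℂ (fun x => (x - z) ^ n * g x) z := by fun_prop
    exact this.congr (h.mono fun x hx => hx.symm)
  exact fa.analyticOrderAt_eq_natCast.2 ⟨g, ga, h0, h⟩

/-- In the upper half-plane f - w is (ζ - ζ₁)(ζ - ζ₂) times a zero-free holomorphic factor. If the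
roots coincide, the single point has order 2, so the formula counts it twice. -/
theorem sheetNumber_hypMap {a b : ℝ} (ha : 0 < a) {w ζ₁ ζ₂ : ℂ}
    (h1 : ((a : ℂ) - Complex.I * b) * (ζ₁ + ζ₂) = 2 * w)
    (h2 : ((a : ℂ) - Complex.I * b) * (ζ₁ * ζ₂) = (a : ℂ) + Complex.I * b) :
    sheetNumber (hypMap a b) upperHalf w =
      (if 0 < ζ₁.im then 1 else 0) + (if 0 < ζ₂.im then 1 else 0) := by
  have hα := sub_I_mul_ne_zero b ha
  have hmem : ∀ ζ, ζ ∈ {ζ | ζ ∈ upperHalf ∧ hypMap a b ζ = w} ↔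
      0 < ζ.im ∧ (ζ = ζ₁ ∨ ζ = ζ₂) := by
    intro ζ
    simp only [upperHalf, mem_ofPred_eq]
    refine and_congr_right fun hζ => ?_
    have h0 : ζ ≠ 0 := by rintro rfl; simp at hζ
    rw [← sub_eq_zero, hypMap_sub_eq h1 h2 h0, mul_eq_zero, mul_eq_zero, sub_eq_zero, sub_eq_zero]
    have : ((a : ℂ) - Complex.I * b) / (2 * ζ) ≠ 0 := div_ne_zero hα (by simpa using h0)
    simp [this]
  have hne : ∀ ζ : ℂ, 0 < ζ.im → ∀ᶠ x in nhds ζ, x ≠ 0 := by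
    intro ζ hζ
    refine isOpen_ne.mem_nhds ?_
    rintro rfl; simp at hζ
  have hgood : ∀ ζ : ℂ, 0 < ζ.im → ((a : ℂ) - Complex.I * b) / (2 * ζ) ≠ 0 := by
    intro ζ hζ
    have h0 : ζ ≠ 0 := by rintro rfl; simp at hζ
    exact div_ne_zero hα (by simpa using h0)
  have hsimple : ∀ ξ₁ ξ₂ : ℂ, ((a : ℂ) - Complex.I * b) * (ξ₁ + ξ₂) = 2 * w →
      ((a : ℂ) - Complex.I * b) * (ξ₁ * ξ₂) = (a : ℂ) + Complex.I * b → ξ₁ ≠ ξ₂ →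
      0 < ξ₁.im → analyticOrderNatAt (fun η => hypMap a b η - w) ξ₁ = 1 := by
    intro ξ₁ ξ₂ h1 h2 hne' him
    have := analyticOrderAt_eq_of_eventuallyEq (f := fun η => hypMap a b η - w) (n := 1) (z := ξ₁)
      (g := fun η => (η - ξ₂) * (((a : ℂ) - Complex.I * b) / (2 * η))) ?_ ?_ ?_
    · rw [analyticOrderNatAt, this]; rfl
    · filter_upwards [hne ξ₁ him] with x hx
      fun_prop (disch := simpa using hx)
    · exact mul_ne_zero (sub_ne_zero.2 hne') (hgood _ him)
    · filter_upwards [hne ξ₁ him] with x hx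
      rw [hypMap_sub_eq h1 h2 hx, pow_one]
  unfold sheetNumber
  by_cases h12 : ζ₁ = ζ₂
  · subst h12
    by_cases him : 0 < ζ₁.im
    · have hs : {ζ | ζ ∈ upperHalf ∧ hypMap a b ζ = w} = {ζ₁} := by
        ext ζ
        rw [hmem]
        simp only [or_self, mem_singleton_iff]
        exact ⟨fun h => h.2, by rintro rfl; exact ⟨him, rfl⟩⟩
      rw [hs, finsum_mem_singleton]
      have := analyticOrderAt_eq_of_eventuallyEq (f := fun η => hypMap a b η - w) (n := 2) (z := ζ₁)
        (g := fun η => (((a : ℂ) - Complex.I * b) / (2 * η))) ?_ (hgood _ him) ?_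
      · rw [analyticOrderNatAt, this]; simp [him]
      · filter_upwards [hne ζ₁ him] with x hx
        fun_prop (disch := simpa using hx)
      · filter_upwards [hne ζ₁ him] with x hx
        rw [hypMap_sub_eq h1 h2 hx]; ring
    · have hs : {ζ | ζ ∈ upperHalf ∧ hypMap a b ζ = w} = ∅ := by
        ext ζ
        rw [hmem]
        simp only [or_self, mem_empty_iff_false, iff_false]
        rintro ⟨h, rfl⟩; exact him h
      rw [hs, finsum_mem_empty]; simp [him]
  · have o1 := hsimple ζ₁ ζ₂ h1 h2 h12
    have o2 := hsimple ζ₂ ζ₁ (by rwa [add_comm]) (by rwa [mul_comm ζ₂]) (Ne.symm h12)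
    by_cases i1 : 0 < ζ₁.im <;> by_cases i2 : 0 < ζ₂.im
    · have hs : {ζ | ζ ∈ upperHalf ∧ hypMap a b ζ = w} = {ζ₁, ζ₂} := by
        ext ζ
        rw [hmem]
        simp only [mem_insert_iff, mem_singleton_iff]
        exact ⟨fun h => h.2, by rintro (rfl | rfl) <;> simp [i1, i2]⟩
      rw [hs, finsum_mem_pair h12, o1 i1, o2 i2]; simp [i1, i2]
    · have hs : {ζ | ζ ∈ upperHalf ∧ hypMap a b ζ = w} = {ζ₁} := by
        ext ζ
        rw [hmem]
        simp only [mem_singleton_iff]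
        constructor
        · rintro ⟨h, rfl | rfl⟩
          · rfl
          · exact absurd h i2
        · rintro rfl; simp [i1]
      rw [hs, finsum_mem_singleton, o1 i1]; simp [i1, i2]
    · have hs : {ζ | ζ ∈ upperHalf ∧ hypMap a b ζ = w} = {ζ₂} := by
        ext ζ
        rw [hmem]
        simp only [mem_singleton_iff]
        constructor
        · rintro ⟨h, rfl | rfl⟩
          · exact absurd h i1
          · rfl
        · rintro rfl; simp [i2]
      rw [hs, finsum_mem_singleton, o2 i2]; simp [i1, i2]
    · have hs : {ζ | ζ ∈ upperHalf ∧ hypMap a b ζ = w} = ∅ := by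
        ext ζ
        rw [hmem]
        simp only [mem_empty_iff_false, iff_false]
        rintro ⟨h, rfl | rfl⟩
        · exact i1 h
        · exact i2 h
      rw [hs, finsum_mem_empty]; simp [i1, i2]

/-- The sign of the product of the imaginary parts tells the middle region from the outer ones; the
sign of their sum then tells the right region from the left. Both formulas follow from the real and
imaginary parts of Vieta's relations. -/
theorem hypForm_sub_one_eq {a b : ℝ} (ha : 0 < a) (hb : 0 < b) {w ζ₁ ζ₂ : ℂ}
    (h1 : ((a : ℂ) - Complex.I * b) * (ζ₁ + ζ₂) = 2 * w)
    (h2 : ((a : ℂ) - Complex.I * b) * (ζ₁ * ζ₂) = (a : ℂ) + Complex.I * b) :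
    (∃ K : ℝ, 0 < K ∧ hypForm a b w - 1 = K * (ζ₁.im * ζ₂.im)) ∧
    (a ^ 2 + b ^ 2) * (ζ₁.im + ζ₂.im) = 2 * (b * w.re + a * w.im) := by
  obtain ⟨x₁, y₁⟩ := ζ₁
  obtain ⟨x₂, y₂⟩ := ζ₂
  obtain ⟨u, v⟩ := w
  have e1 := congrArg Complex.re h1
  have e2 := congrArg Complex.im h1
  have e3 := congrArg Complex.re h2
  have e4 := congrArg Complex.im h2
  simp at e1 e2 e3 e4
  have hc : 0 < a ^ 2 + b ^ 2 := by positivity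
  have f1 : (a ^ 2 + b ^ 2) * (x₁ * x₂ - y₁ * y₂) = a ^ 2 - b ^ 2 := by
    linear_combination a * e3 - b * e4
  have f2 : (a ^ 2 + b ^ 2) * (x₁ * y₂ + y₁ * x₂) = 2 * a * b := by
    linear_combination b * e3 + a * e4
  refine ⟨⟨(a ^ 2 + b ^ 2) ^ 2 * ((x₁ - x₂) ^ 2 + (y₁ + y₂) ^ 2) / (4 * a ^ 2 * b ^ 2), ?_, ?_⟩, ?_⟩
  -- This is |ζ₁ - conj ζ₂|². If it vanished, ζ₁ζ₂ would be real, whereas its imaginary part is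
  -- 2ab/(a² + b²) > 0.
  · have : 0 < (x₁ - x₂) ^ 2 + (y₁ + y₂) ^ 2 := by
      by_contra! hcon
      have g1 : x₁ - x₂ = 0 := by nlinarith [sq_nonneg (x₁ - x₂), sq_nonneg (y₁ + y₂)]
      have g2 : y₁ + y₂ = 0 := by nlinarith [sq_nonneg (x₁ - x₂), sq_nonneg (y₁ + y₂)]
      have g3 : x₁ * y₂ + y₁ * x₂ = 0 := by linear_combination x₁ * g2 - y₁ * g1
      rw [g3] at f2
      have : 0 < 2 * a * b := by positivity
      linarith
    positivity
  · simp only [hypForm]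
    have hu : u = (a * (x₁ + x₂) + b * (y₁ + y₂)) / 2 := by linarith
    have hv : v = (a * (y₁ + y₂) - b * (x₁ + x₂)) / 2 := by linarith
    rw [hu, hv]
    field_simp
    linear_combination 4 * (a ^ 2 + b ^ 2) * (y₁ + y₂) ^ 2 * f1 -
      4 * ((a ^ 2 + b ^ 2) * (x₁ + x₂) * (y₁ + y₂) -
        (a ^ 2 + b ^ 2) * (x₁ * y₂ + y₁ * x₂) - 2 * a * b) * f2
  · linear_combination a * e2 + b * e1

theorem sheetNumber_hypMap_upperHalf {a b : ℝ} (ha : 0 < a) (hb : 0 < b) {w : ℂ}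
    (hw : w ∉ hyperbola a b) : sheetNumber (hypMap a b) upperHalf w =
      2 * (hyperbolaRight a b).indicator 1 w + 1 * (hyperbolaMid a b).indicator 1 w := by
  obtain ⟨ζ₁, ζ₂, h1, h2⟩ := exists_hypMap_roots b ha w
  obtain ⟨⟨K, hK, hq⟩, hs⟩ := hypForm_sub_one_eq ha hb h1 h2
  rw [sheetNumber_hypMap ha h1 h2, hyperbolaMid_eq, hyperbolaRight_eq ha hb]
  have hw' : hypForm a b w ≠ 1 := hw
  have hc : 0 < a ^ 2 + b ^ 2 := by positivity
  simp only [indicator_apply, mem_ofPred_eq, Pi.one_apply]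
  rcases lt_or_gt_of_ne hw' with h | h
  · have hp : ζ₁.im * ζ₂.im < 0 := by
      by_contra! hcon
      have := mul_nonneg hK.le hcon
      linarith
    simp only [h, not_lt.2 h.le, false_and, if_true, if_false]
    rcases mul_neg_iff.1 hp with ⟨i, j⟩ | ⟨i, j⟩
    · simp [i, not_lt.2 j.le]
    · simp [j, not_lt.2 i.le]
  · have hp : 0 < ζ₁.im * ζ₂.im := by
      by_contra! hcon
      have := mul_nonpos_of_nonneg_of_nonpos hK.le hcon
      linarith
    -- Beyond the hyperbola b Re w dominates a Im w, so the sum of the imaginary parts has the sign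
    -- of Re w.
    have habs : (a * w.im) ^ 2 < (b * w.re) ^ 2 := by
      have h' := h
      rw [hypForm] at h'
      have : w.im ^ 2 / b ^ 2 < w.re ^ 2 / a ^ 2 := by linarith
      rw [div_lt_div_iff₀ (by positivity) (by positivity)] at this
      nlinarith
    have habs' := sq_lt_sq.1 habs
    simp only [h, not_lt.2 h.le, true_and, if_false]
    rcases lt_trichotomy w.re 0 with hr | hr | hr
    · have hbr : b * w.re < 0 := mul_neg_of_pos_of_neg hb hr
      rw [abs_of_neg hbr, abs_lt] at habs'
      have : ζ₁.im + ζ₂.im < 0 := by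
        by_contra! hcon
        have := mul_nonneg hc.le hcon
        linarith
      rcases mul_pos_iff.1 hp with ⟨i, j⟩ | ⟨i, j⟩
      · linarith
      · simp [not_lt.2 i.le, not_lt.2 j.le, not_lt.2 hr.le]
    · rw [hr] at habs; nlinarith [sq_nonneg (a * w.im)]
    · have hbr : 0 < b * w.re := mul_pos hb hr
      rw [abs_of_pos hbr, abs_lt] at habs'
      have : 0 < ζ₁.im + ζ₂.im := by
        by_contra! hcon
        have := mul_nonpos_of_nonneg_of_nonpos hc.le hcon
        linarith
      rcases mul_pos_iff.1 hp with ⟨i, j⟩ | ⟨i, j⟩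
      · simp [i, j, hr]
      · linarith

/-! ### The nodes and the factorization of 1 + ff* -/

theorem hypRoot_sq (a b : ℝ) : hypRoot a b ^ 2 = (1 + (a : ℂ) ^ 2) * (1 - (b : ℂ) ^ 2) := by
  rw [hypRoot, ← Complex.cpow_nat_mul]
  norm_num

theorem hypRoot_of_le {a b : ℝ} (hb : 0 < b) (h : b ≤ 1) :
    hypRoot a b = (Real.sqrt ((1 + a ^ 2) * (1 - b ^ 2)) : ℂ) := by
  have h0 : 0 ≤ (1 + a ^ 2) * (1 - b ^ 2) := mul_nonneg (by positivity) (by nlinarith)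
  rw [hypRoot, Real.sqrt_eq_rpow, Complex.ofReal_cpow h0]
  norm_num

theorem hypRoot_of_lt {a b : ℝ} (h : 1 < b) :
    hypRoot a b = Complex.I * (Real.sqrt ((a ^ 2 + 1) * (b ^ 2 - 1)) : ℂ) := by
  set x := (1 + a ^ 2) * (1 - b ^ 2) with hx
  have hneg : x < 0 := mul_neg_of_pos_of_neg (by positivity) (by nlinarith)
  have hx' : (a ^ 2 + 1) * (b ^ 2 - 1) = -x := by rw [hx]; ring
  rw [hypRoot, ← hx, hx', one_div]
  apply Complex.ext
  · rw [Complex.cpow_inv_two_re]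
    simp [abs_of_neg hneg]
  · rw [Complex.cpow_inv_two_im_eq_sqrt (by simp)]
    simp only [Complex.norm_real, Real.norm_eq_abs, abs_of_neg hneg, Complex.ofReal_re,
      Complex.I_mul_im]
    congr 1; ring

theorem upperSqrt_sq (w : ℂ) : upperSqrt w ^ 2 = w := by
  rw [upperSqrt, mul_pow, ← Complex.cpow_nat_mul]
  norm_num

theorem upperSqrt_im (w : ℂ) : (upperSqrt w).im = Real.sqrt ((‖w‖ - w.re) / 2) := by
  rw [upperSqrt, Complex.I_mul_im, one_div, Complex.cpow_inv_two_re, norm_neg, Complex.neg_re]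
  rfl

theorem upperSqrt_re_of_im_pos {w : ℂ} (hw : 0 < w.im) : 0 < (upperSqrt w).re := by
  rw [upperSqrt, Complex.I_mul_re, one_div, Complex.cpow_inv_two_im_eq_neg_sqrt (by simpa using hw),
    neg_neg, norm_neg, Complex.neg_re]
  apply Real.sqrt_pos.2
  have := (abs_lt.1 (Complex.abs_re_lt_norm.2 hw.ne')).1
  linarith

theorem upperSqrt_re_of_im_neg {w : ℂ} (hw : w.im < 0) : (upperSqrt w).re < 0 := by
  rw [upperSqrt, Complex.I_mul_re, one_div, Complex.cpow_inv_two_im_eq_sqrt (by simpa using hw.le),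
    norm_neg, Complex.neg_re, neg_lt_zero]
  apply Real.sqrt_pos.2
  have := (abs_lt.1 (Complex.abs_re_lt_norm.2 hw.ne)).1
  linarith

theorem upperSqrt_im_pos_of_im_ne {w : ℂ} (hw : w.im ≠ 0) : 0 < (upperSqrt w).im := by
  rw [upperSqrt_im]
  apply Real.sqrt_pos.2
  have := (abs_lt.1 (Complex.abs_re_lt_norm.2 hw)).2
  linarith

theorem upperSqrt_neg_ofReal {x : ℝ} (hx : 0 ≤ x) :
    upperSqrt (-(x : ℂ)) = Complex.I * (Real.sqrt x : ℂ) := by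
  rw [upperSqrt, neg_neg, Real.sqrt_eq_rpow, Complex.ofReal_cpow hx]
  norm_num

theorem focalRadius_pos {a : ℝ} (b : ℝ) (ha : 0 < a) : 0 < focalRadius a b :=
  Real.sqrt_pos.2 (by positivity)

theorem focalRadius_sq (a b : ℝ) : (focalRadius a b : ℂ) ^ 2 = (a : ℂ) ^ 2 + (b : ℂ) ^ 2 := by
  have : (focalRadius a b) ^ 2 = a ^ 2 + b ^ 2 := Real.sq_sqrt (by positivity)
  exact_mod_cast this

theorem focal_sq_ne_zero {a : ℝ} (b : ℝ) (ha : 0 < a) : (a : ℂ) ^ 2 + (b : ℂ) ^ 2 ≠ 0 := by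
  rw [← focalRadius_sq]
  have := (focalRadius_pos b ha).ne'
  exact pow_ne_zero 2 (by exact_mod_cast this)

theorem hypNode₁_sq {a : ℝ} (b : ℝ) (ha : 0 < a) : ((a : ℂ) ^ 2 + (b : ℂ) ^ 2) * hypNode₁ a b ^ 2 =
    -(2 + (a : ℂ) ^ 2 - (b : ℂ) ^ 2) + 2 * hypRoot a b := by
  have h := focal_sq_ne_zero b ha
  rw [hypNode₁, div_pow, upperSqrt_sq, focalRadius_sq]
  field_simp

theorem hypNode₂_sq {a : ℝ} (b : ℝ) (ha : 0 < a) : ((a : ℂ) ^ 2 + (b : ℂ) ^ 2) * hypNode₂ a b ^ 2 =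
    -(2 + (a : ℂ) ^ 2 - (b : ℂ) ^ 2) - 2 * hypRoot a b := by
  have h := focal_sq_ne_zero b ha
  rw [hypNode₂, div_pow, upperSqrt_sq, focalRadius_sq]
  field_simp

theorem reflected_hypMap (a b : ℝ) (ζ : ℂ) : reflected (hypMap a b) ζ =
    (1 / 2) * (((a : ℂ) + Complex.I * b) * ζ + ((a : ℂ) - Complex.I * b) * ζ⁻¹) := by
  simp only [reflected, hypMap, map_mul, map_add, map_sub, map_inv₀, map_div₀, map_one, map_ofNat,
    Complex.conj_conj, Complex.conj_I, Complex.conj_ofReal]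
  ring

/-- Expanding gives 4ζ²(1 + ff*) = c²ζ⁴ + 2(2 + a² - b²)ζ² + c², and (2 + a² - b²)² - c⁴ = 4(1 +
a²)(1 - b²) identifies the roots in ζ². -/
theorem one_add_hypMap_mul_reflected {a : ℝ} (b : ℝ) (ha : 0 < a) {ζ : ℂ} (hζ : ζ ≠ 0) :
    1 + hypMap a b ζ * reflected (hypMap a b) ζ = ((a : ℂ) ^ 2 + (b : ℂ) ^ 2) *
      (ζ ^ 2 - hypNode₁ a b ^ 2) * (ζ ^ 2 - hypNode₂ a b ^ 2) / (4 * ζ ^ 2) := by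
  have h := focal_sq_ne_zero b ha
  have e1 : hypNode₁ a b ^ 2 = (-(2 + (a : ℂ) ^ 2 - (b : ℂ) ^ 2) + 2 * hypRoot a b) /
      ((a : ℂ) ^ 2 + (b : ℂ) ^ 2) := by rw [← hypNode₁_sq b ha]; field_simp
  have e2 : hypNode₂ a b ^ 2 = (-(2 + (a : ℂ) ^ 2 - (b : ℂ) ^ 2) - 2 * hypRoot a b) /
      ((a : ℂ) ^ 2 + (b : ℂ) ^ 2) := by rw [← hypNode₂_sq b ha]; field_simp
  rw [reflected_hypMap, hypMap, e1, e2]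
  field_simp
  ring_nf
  rw [Complex.I_sq, hypRoot_sq]
  ring

theorem hypNode_of_lt_one {a b : ℝ} (ha : 0 < a) (hb : 0 < b) (h : b ≤ 1) :
    (hypNode₁ a b).re = 0 ∧ (hypNode₂ a b).re = 0 ∧ 0 < (hypNode₁ a b).im ∧
      0 < (hypNode₂ a b).im ∧ (b < 1 → (hypNode₁ a b).im < (hypNode₂ a b).im) := by
  set R := Real.sqrt ((1 + a ^ 2) * (1 - b ^ 2)) with hR
  have h0 : 0 ≤ (1 + a ^ 2) * (1 - b ^ 2) := mul_nonneg (by positivity) (by nlinarith)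
  have hRn : 0 ≤ R := Real.sqrt_nonneg _
  have hRs : R ^ 2 = (1 + a ^ 2) * (1 - b ^ 2) := Real.sq_sqrt h0
  -- The squares of the two sides differ by exactly (a² + b²)². Hence both radicands are negative
  -- and both nodes are purely imaginary.
  have hlt : 2 * R < 2 + a ^ 2 - b ^ 2 := by
    have : 0 < 2 + a ^ 2 - b ^ 2 := by nlinarith [sq_nonneg a]
    apply lt_of_pow_lt_pow_left₀ 2 this.le
    have : 0 < (a ^ 2 + b ^ 2) ^ 2 := by positivity
    nlinarith
  have hc := focalRadius_pos b ha
  have e1 : hypNode₁ a b = ((Real.sqrt (2 + a ^ 2 - b ^ 2 - 2 * R) / focalRadius a b : ℝ) : ℂ) *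
      Complex.I := by
    rw [hypNode₁, hypRoot_of_le hb h, ← hR]
    rw [show -(2 + (a : ℂ) ^ 2 - (b : ℂ) ^ 2) + 2 * (R : ℂ) =
      -((2 + a ^ 2 - b ^ 2 - 2 * R : ℝ) : ℂ) by push_cast; ring, upperSqrt_neg_ofReal (by linarith)]
    push_cast; ring
  have e2 : hypNode₂ a b = ((Real.sqrt (2 + a ^ 2 - b ^ 2 + 2 * R) / focalRadius a b : ℝ) : ℂ) *
      Complex.I := by
    rw [hypNode₂, hypRoot_of_le hb h, ← hR]
    rw [show -(2 + (a : ℂ) ^ 2 - (b : ℂ) ^ 2) - 2 * (R : ℂ) =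
      -((2 + a ^ 2 - b ^ 2 + 2 * R : ℝ) : ℂ) by push_cast; ring, upperSqrt_neg_ofReal (by linarith)]
    push_cast; ring
  rw [e1, e2]
  simp only [Complex.re_ofReal_mul, Complex.I_re, mul_zero, Complex.im_ofReal_mul, Complex.I_im,
    mul_one, true_and]
  refine ⟨div_pos (Real.sqrt_pos.2 (by linarith)) hc, div_pos (Real.sqrt_pos.2 (by linarith)) hc,
    fun h1 => ?_⟩
  have : 0 < R := Real.sqrt_pos.2 (mul_pos (by positivity) (by nlinarith))
  exact div_lt_div_of_pos_right (Real.sqrt_lt_sqrt (by linarith) (by linarith)) hc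

theorem hypNode_of_one_lt {a b : ℝ} (ha : 0 < a) (h : 1 < b) :
    0 < (hypNode₁ a b).re ∧ 0 < (hypNode₁ a b).im ∧
      (hypNode₂ a b).re < 0 ∧ 0 < (hypNode₂ a b).im := by
  have hc := focalRadius_pos b ha
  have hR : 0 < Real.sqrt ((a ^ 2 + 1) * (b ^ 2 - 1)) :=
    Real.sqrt_pos.2 (mul_pos (by positivity) (by nlinarith))
  -- For b > 1 the radicands are non-real conjugates; the square root with positive imaginary part
  -- sends the upper half-plane to the first quadrant and the lower one to the second.
  have i1 : 0 < (-(2 + (a : ℂ) ^ 2 - (b : ℂ) ^ 2) + 2 * hypRoot a b).im := by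
    rw [hypRoot_of_lt h]
    simpa [← Complex.ofReal_pow] using hR
  have i2 : (-(2 + (a : ℂ) ^ 2 - (b : ℂ) ^ 2) - 2 * hypRoot a b).im < 0 := by
    rw [hypRoot_of_lt h]
    simpa [← Complex.ofReal_pow] using hR
  rw [hypNode₁, hypNode₂]
  simp only [Complex.div_ofReal_re, Complex.div_ofReal_im]
  exact ⟨div_pos (upperSqrt_re_of_im_pos i1) hc, div_pos (upperSqrt_im_pos_of_im_ne i1.ne') hc,
    div_neg_of_neg_of_pos (upperSqrt_re_of_im_neg i2) hc,
    div_pos (upperSqrt_im_pos_of_im_ne i2.ne) hc⟩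

theorem hypNode_im_pos {a b : ℝ} (ha : 0 < a) (hb : 0 < b) :
    0 < (hypNode₁ a b).im ∧ 0 < (hypNode₂ a b).im := by
  rcases le_or_gt b 1 with h | h
  · obtain ⟨-, -, h1, h2, -⟩ := hypNode_of_lt_one ha hb h
    exact ⟨h1, h2⟩
  · obtain ⟨-, h1, -, h2⟩ := hypNode_of_one_lt ha h
    exact ⟨h1, h2⟩

theorem eq_of_sq_eq_of_im_pos {z w : ℂ} (hz : 0 < z.im) (hw : 0 < w.im) (h : z ^ 2 = w ^ 2) :
    z = w := by
  rcases sq_eq_sq_iff_eq_or_eq_neg.1 h with h | h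
  · exact h
  · rw [h, Complex.neg_im] at hz; linarith

theorem hypNode_eq_I {a : ℝ} (ha : 0 < a) : hypNode₁ a 1 = Complex.I ∧ hypNode₂ a 1 = Complex.I := by
  have h := focal_sq_ne_zero 1 ha
  have hR : hypRoot a 1 = 0 := by
    have := hypRoot_sq a 1
    simpa using this
  have e1 := hypNode₁_sq 1 ha
  have e2 := hypNode₂_sq 1 ha
  rw [hR] at e1 e2
  obtain ⟨h1, h2⟩ := hypNode_im_pos (b := 1) ha one_pos
  constructor
  · refine eq_of_sq_eq_of_im_pos h1 (by simp) (mul_left_cancel₀ h ?_)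
    rw [e1, Complex.I_sq]; push_cast; ring
  · refine eq_of_sq_eq_of_im_pos h2 (by simp) (mul_left_cancel₀ h ?_)
    rw [e2, Complex.I_sq]; push_cast; ring

theorem roots_one_add_hypMap_mul_reflected {a b : ℝ} (ha : 0 < a) (hb : 0 < b) :
    {ζ | ζ ∈ upperHalf ∧ 1 + hypMap a b ζ * reflected (hypMap a b) ζ = 0} =
      {hypNode₁ a b, hypNode₂ a b} := by
  obtain ⟨h1, h2⟩ := hypNode_im_pos ha hb
  have hc := focal_sq_ne_zero b ha
  ext ζ
  simp only [upperHalf, mem_ofPred_eq, mem_insert_iff, mem_singleton_iff]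
  constructor
  · rintro ⟨hζ, h⟩
    have h0 : ζ ≠ 0 := by rintro rfl; simp at hζ
    rw [one_add_hypMap_mul_reflected b ha h0, div_eq_zero_iff, mul_eq_zero, mul_eq_zero] at h
    rcases h with ((h | h) | h) | h
    · exact absurd h hc
    · exact Or.inl (eq_of_sq_eq_of_im_pos hζ h1 (sub_eq_zero.1 h))
    · exact Or.inr (eq_of_sq_eq_of_im_pos hζ h2 (sub_eq_zero.1 h))
    · simp [h0] at h
  · intro h
    have hζ : 0 < ζ.im := by rcases h with rfl | rfl <;> assumption
    have h0 : ζ ≠ 0 := by rintro rfl; simp at hζ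
    refine ⟨hζ, ?_⟩
    rw [one_add_hypMap_mul_reflected b ha h0]
    rcases h with rfl | rfl <;> simp

theorem analyticOrderAt_one_add_hypMap_mul_reflected {a : ℝ} (ha : 0 < a) :
    analyticOrderAt (fun ζ => 1 + hypMap a 1 ζ * reflected (hypMap a 1) ζ) Complex.I = 2 := by
  have hc := focal_sq_ne_zero 1 ha
  have hn : ∀ᶠ x in nhds Complex.I, x ≠ 0 := isOpen_ne.mem_nhds Complex.I_ne_zero
  refine analyticOrderAt_eq_of_eventuallyEq (n := 2)
    (g := fun ζ => ((a : ℂ) ^ 2 + ((1 : ℝ) : ℂ) ^ 2) * (ζ + Complex.I) ^ 2 / (4 * ζ ^ 2)) ?_ ?_ ?_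
  · filter_upwards [hn] with x hx
    fun_prop (disch := simpa using hx)
  · refine div_ne_zero (mul_ne_zero hc ?_) (by simp)
    simp [← two_mul]
  · filter_upwards [hn] with x hx
    obtain ⟨h1, h2⟩ := hypNode_eq_I ha
    rw [one_add_hypMap_mul_reflected 1 ha hx, h1, h2]
    field_simp
    ring

/-! ### Green's theorem on a disc in polar coordinates -/

/-- Polar coordinates, as a map from `ℝ × ℝ`. -/
noncomputable def polarMap (p : ℝ × ℝ) : ℂ := p.1 * Complex.exp (p.2 * Complex.I)

theorem norm_polarMap (p : ℝ × ℝ) : ‖polarMap p‖ = |p.1| := by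
  simp [polarMap, Complex.norm_exp_ofReal_mul_I]

theorem continuous_polarMap : Continuous polarMap := by
  unfold polarMap; fun_prop

theorem polarCoord_symm_eq_polarMap (p : ℝ × ℝ) : Complex.polarCoord.symm p = polarMap p := by
  rw [Complex.polarCoord_symm_apply, polarMap, Complex.exp_mul_I]
  push_cast; rfl

theorem polar_target_inter (r : ℝ) :
    polarCoord.target ∩ {p : ℝ × ℝ | polarMap p ∈ Metric.ball (0 : ℂ) r} =
      Ioo 0 r ×ˢ Ioo (-Real.pi) Real.pi := by
  ext ⟨s, t⟩
  simp only [polarCoord_target, mem_inter_iff, mem_prod, mem_Ioi, mem_Ioo, mem_ofPred_eq,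
    mem_ball_zero_iff, norm_polarMap]
  constructor
  · rintro ⟨⟨h1, h2⟩, h3⟩
    rw [abs_of_pos h1] at h3
    exact ⟨⟨h1, h3⟩, h2⟩
  · rintro ⟨⟨h1, h3⟩, h2⟩
    rw [abs_of_pos h1]
    exact ⟨⟨h1, h2⟩, h3⟩

theorem setIntegral_ball_eq_polar (w : ℂ → ℂ) (r : ℝ) :
    ∫ z in Metric.ball 0 r, w z =
      ∫ p in Ioo 0 r ×ˢ Ioo (-Real.pi) Real.pi, (p.1 : ℂ) * w (polarMap p) := by
  have hm : MeasurableSet {p : ℝ × ℝ | polarMap p ∈ Metric.ball (0 : ℂ) r} :=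
    continuous_polarMap.measurable measurableSet_ball
  rw [← integral_indicator measurableSet_ball, ← Complex.integral_comp_polarCoord_symm,
    ← polar_target_inter, ← setIntegral_indicator hm]
  congr 1
  ext p
  simp only [polarCoord_symm_eq_polarMap, Complex.real_smul]
  by_cases h : polarMap p ∈ Metric.ball (0 : ℂ) r
  · rw [indicator_of_mem h, indicator_of_mem (mem_ofPred_eq ▸ h)]
  · rw [indicator_of_notMem h, indicator_of_notMem (mem_ofPred_eq ▸ h), mul_zero]

theorem lintegral_ball_eq_polar (w : ℂ → ENNReal) (r : ℝ) :
    ∫⁻ z in Metric.ball 0 r, w z =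
      ∫⁻ p in Ioo 0 r ×ˢ Ioo (-Real.pi) Real.pi, ENNReal.ofReal p.1 * w (polarMap p) := by
  have hm : MeasurableSet {p : ℝ × ℝ | polarMap p ∈ Metric.ball (0 : ℂ) r} :=
    continuous_polarMap.measurable measurableSet_ball
  rw [← lintegral_indicator measurableSet_ball, ← Complex.lintegral_comp_polarCoord_symm,
    ← polar_target_inter, inter_comm, ← setLIntegral_indicator hm]
  congr 1
  ext p
  simp only [polarCoord_symm_eq_polarMap, smul_eq_mul]
  by_cases h : polarMap p ∈ Metric.ball (0 : ℂ) r
  · rw [indicator_of_mem h, indicator_of_mem (mem_ofPred_eq ▸ h)]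
  · rw [indicator_of_notMem h, indicator_of_notMem (mem_ofPred_eq ▸ h), mul_zero]

theorem integrableOn_polar {w : ℂ → ℂ} {r : ℝ} (hc : ContinuousOn w (Metric.ball 0 r))
    (hi : IntegrableOn w (Metric.ball 0 r)) :
    IntegrableOn (fun p : ℝ × ℝ => (p.1 : ℂ) * w (polarMap p))
      (Ioo 0 r ×ˢ Ioo (-Real.pi) Real.pi) := by
  have hms : MeasurableSet (Ioo 0 r ×ˢ Ioo (-Real.pi) Real.pi) :=
    measurableSet_Ioo.prod measurableSet_Ioo
  have hsub : ∀ p ∈ Ioo 0 r ×ˢ Ioo (-Real.pi) Real.pi, polarMap p ∈ Metric.ball (0 : ℂ) r := by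
    intro p hp
    rw [← polar_target_inter] at hp
    exact hp.2
  refine ⟨ContinuousOn.aestronglyMeasurable ?_ hms, ?_⟩
  · exact (Complex.continuous_ofReal.comp continuous_fst).continuousOn.mul
      (hc.comp continuous_polarMap.continuousOn hsub)
  · have h := hi.2
    rw [hasFiniteIntegral_iff_enorm, lintegral_ball_eq_polar] at h
    rw [hasFiniteIntegral_iff_enorm]
    refine lt_of_eq_of_lt (setLIntegral_congr_fun hms fun p hp => ?_) h
    simp only [enorm_mul]
    congr 1
    rw [← ofReal_norm, Complex.norm_real, Real.norm_of_nonneg hp.1.1.le]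

theorem circleIntegral_eq_integral_polarMap (g : ℂ → ℂ) (r : ℝ) :
    ∮ z in C(0, r), g z = ∫ t in (-Real.pi)..Real.pi,
      Complex.I * polarMap (r, t) * g (polarMap (r, t)) := by
  have hp : Function.Periodic (fun t : ℝ => Complex.I * polarMap (r, t) * g (polarMap (r, t)))
      (2 * Real.pi) := by
    intro t
    have : polarMap (r, t + 2 * Real.pi) = polarMap (r, t) := by
      simp [polarMap, add_mul, Complex.exp_add, Complex.exp_two_pi_mul_I]
    simp only [this]
  have := hp.intervalIntegral_add_eq 0 (-Real.pi)
  rw [show -Real.pi + 2 * Real.pi = Real.pi by ring, zero_add] at this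
  rw [← this, circleIntegral]
  refine intervalIntegral.integral_congr fun t _ => ?_
  simp only [deriv_circleMap, circleMap, polarMap, zero_add, smul_eq_mul]
  ring

theorem hasFDerivAt_exp_snd (p : ℝ × ℝ) :
    HasFDerivAt (fun p : ℝ × ℝ => Complex.exp (p.2 * Complex.I))
      ((ContinuousLinearMap.snd ℝ ℝ ℝ).smulRight (Complex.I * Complex.exp (p.2 * Complex.I))) p := by
  have h2 : HasFDerivAt (fun p : ℝ × ℝ => (p.2 : ℂ))
      (Complex.ofRealCLM.comp (ContinuousLinearMap.snd ℝ ℝ ℝ)) p :=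
    (Complex.ofRealCLM.comp (ContinuousLinearMap.snd ℝ ℝ ℝ)).hasFDerivAt
  refine (h2.mul_const Complex.I).cexp.congr_fderiv ?_
  ext
  · simp
  · simp; ring

theorem hasFDerivAt_polarMap (p : ℝ × ℝ) : HasFDerivAt polarMap
    ((ContinuousLinearMap.fst ℝ ℝ ℝ).smulRight (Complex.exp (p.2 * Complex.I)) +
      (ContinuousLinearMap.snd ℝ ℝ ℝ).smulRight (Complex.I * polarMap p)) p := by
  have h1 : HasFDerivAt (fun p : ℝ × ℝ => (p.1 : ℂ))
      (Complex.ofRealCLM.comp (ContinuousLinearMap.fst ℝ ℝ ℝ)) p :=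
    (Complex.ofRealCLM.comp (ContinuousLinearMap.fst ℝ ℝ ℝ)).hasFDerivAt
  refine (h1.mul (hasFDerivAt_exp_snd p)).congr_fderiv ?_
  ext
  · simp [polarMap]
  · simp [polarMap]; ring

/-- **Green's theorem** on a disc, in complex form. -/
theorem circleIntegral_eq_setIntegral_ball {g q : ℂ → ℂ} {g' : ℂ → ℂ →L[ℝ] ℂ} {r : ℝ} (hr : 0 ≤ r)
    (hg : ∀ z ∈ Metric.closedBall 0 r, HasFDerivAt g (g' z) z)
    (hq : ∀ z ∈ Metric.closedBall 0 r, g' z 1 + Complex.I * g' z Complex.I = 2 * q z)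
    (hqc : ContinuousOn q (Metric.closedBall 0 r)) :
    ∮ z in C(0, r), g z = 2 * Complex.I * ∫ z in Metric.ball 0 r, q z := by
  -- Since 2∂̄ = e^{iθ}(∂_r + (i/r)∂_θ), the field (f, k) has divergence 2ir ∂̄g: the terms i e^{iθ}
  -- g cancel. The hypothesis on q says q = ∂̄g.
  set f : ℝ × ℝ → ℂ := fun p => Complex.I * polarMap p * g (polarMap p) with hf
  set k : ℝ × ℝ → ℂ := fun p => -(Complex.exp (p.2 * Complex.I) * g (polarMap p)) with hk
  have hmem : ∀ p : ℝ × ℝ, p ∈ Icc ((0, -Real.pi) : ℝ × ℝ) (r, Real.pi) →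
      polarMap p ∈ Metric.closedBall (0 : ℂ) r := by
    rintro p ⟨h1, h2⟩
    rw [mem_closedBall_zero_iff, norm_polarMap, abs_of_nonneg h1.1]
    exact h2.1
  have hdf : ∀ p ∈ Icc ((0, -Real.pi) : ℝ × ℝ) (r, Real.pi), HasFDerivAt f _ p := fun p hp =>
    ((hasFDerivAt_polarMap p).const_mul Complex.I).mul
      ((hg _ (hmem p hp)).comp p (hasFDerivAt_polarMap p))
  have hdk : ∀ p ∈ Icc ((0, -Real.pi) : ℝ × ℝ) (r, Real.pi), HasFDerivAt k _ p := fun p hp =>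
    ((hasFDerivAt_exp_snd p).mul ((hg _ (hmem p hp)).comp p (hasFDerivAt_polarMap p))).neg
  have hIoo : Ioo (0 : ℝ) r ×ˢ Ioo (-Real.pi) Real.pi ⊆
      Icc ((0, -Real.pi) : ℝ × ℝ) (r, Real.pi) := by
    rintro p ⟨h1, h2⟩
    exact ⟨⟨h1.1.le, h2.1.le⟩, ⟨h1.2.le, h2.2.le⟩⟩
  have hval : ∀ p ∈ Icc ((0, -Real.pi) : ℝ × ℝ) (r, Real.pi),
      fderiv ℝ f p (1, 0) + fderiv ℝ k p (0, 1) =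
        2 * Complex.I * ((p.1 : ℂ) * q (polarMap p)) := by
    intro p hp
    rw [(hdf p hp).fderiv, (hdk p hp).fderiv]
    have hq' := hq _ (hmem p hp)
    set D := g' (polarMap p)
    have hD : ∀ v : ℂ, D v = v.re * D 1 + v.im * D Complex.I := by
      intro v
      conv_lhs => rw [← Complex.re_add_im v, ← mul_one (v.re : ℂ)]
      rw [← Complex.real_smul, ← Complex.real_smul, map_add, map_smul, map_smul,
        Complex.real_smul, Complex.real_smul]
    simp
    rw [hD (Complex.exp _), hD (Complex.I * polarMap p)]
    simp [polarMap, Complex.exp_ofReal_mul_I_re, Complex.exp_ofReal_mul_I_im]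
    rw [polarMap] at hq'
    generalize q (p.1 * Complex.exp (p.2 * Complex.I)) = Q at *
    rw [Complex.exp_mul_I]
    linear_combination (Complex.I * p.1) * hq' +
      (Complex.I * p.1 * (D 1 + Complex.I * D Complex.I)) * Complex.cos_sq_add_sin_sq p.2 +
      p.1 * (Complex.cos p.2 * Complex.sin p.2 * D 1 - Complex.cos p.2 ^ 2 * D Complex.I) *
        Complex.I_sq
  have hcq : ContinuousOn (fun p : ℝ × ℝ => 2 * Complex.I * ((p.1 : ℂ) * q (polarMap p)))
      (Icc ((0, -Real.pi) : ℝ × ℝ) (r, Real.pi)) :=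
    continuousOn_const.mul ((Complex.continuous_ofReal.comp continuous_fst).continuousOn.mul
      (hqc.comp continuous_polarMap.continuousOn hmem))
  have hint := integral_divergence_prod_Icc_of_hasFDerivAt_of_le f k (fderiv ℝ f) (fderiv ℝ k)
    (0, -Real.pi) (r, Real.pi) ⟨hr, by simp [Real.pi_pos.le]⟩
    (fun p hp => (hdf p hp).continuousAt.continuousWithinAt)
    (fun p hp => (hdk p hp).continuousAt.continuousWithinAt)
    (fun p hp => (hdf p (hIoo hp)).differentiableAt.hasFDerivAt)
    (fun p hp => (hdk p (hIoo hp)).differentiableAt.hasFDerivAt)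
    ((hcq.integrableOn_compact isCompact_Icc).congr_fun (fun p hp => (hval p hp).symm)
      measurableSet_Icc)
  rw [setIntegral_congr_fun measurableSet_Icc hval, integral_const_mul] at hint
  have hae : (Ioo (0 : ℝ) r ×ˢ Ioo (-Real.pi) Real.pi : Set (ℝ × ℝ)) =ᵐ[volume]
      Icc ((0, -Real.pi) : ℝ × ℝ) (r, Real.pi) := by
    rw [Icc_prod_eq, Measure.volume_eq_prod]
    exact Measure.set_prod_ae_eq Ioo_ae_eq_Icc Ioo_ae_eq_Icc
  rw [circleIntegral_eq_integral_polarMap, setIntegral_ball_eq_polar, setIntegral_congr_set hae,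
    hint]
  -- The edges θ = ±π cancel by periodicity and f vanishes on the edge of radius 0, which leaves
  -- only the circle.
  have hper : ∀ x : ℝ, k (x, Real.pi) = k (x, -Real.pi) := by
    intro x
    simp [hk, polarMap, Complex.exp_neg, Complex.exp_pi_mul_I]
  simp only [hper]
  simp [hf, polarMap]

/-! ### Passing to the unit circle without boundary values -/

/-- The integrals over smaller discs converge to the full integral. If the limit were not J, the
bound would force the circle integrals of |w| to be at least a constant over 1 - r near r = 1. But r
times those integrals is integrable by Fubini, and 1/(1 - r) is not. -/
theorem setIntegral_ball_eq_of_bound {w : ℂ → ℂ} (hc : ContinuousOn w (Metric.ball 0 1))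
    (hi : IntegrableOn w (Metric.ball 0 1)) {J : ℂ} {C r₀ : ℝ} (h0 : 0 < r₀) (h1 : r₀ < 1)
    (h : ∀ r ∈ Ioo r₀ 1, ‖(∫ z in Metric.ball 0 r, w z) - J‖ ≤
      C * (1 - r) * ∫ t in (-Real.pi)..Real.pi, ‖w (polarMap (r, t))‖) :
    ∫ z in Metric.ball 0 1, w z = J := by
  by_contra hne
  set V : ℝ → ℝ := fun r => ∫ t in (-Real.pi)..Real.pi, ‖w (polarMap (r, t))‖ with hV
  set δ := ‖(∫ z in Metric.ball 0 1, w z) - J‖ with hδ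
  have hδ0 : 0 < δ := norm_pos_iff.2 (sub_ne_zero.2 hne)
  have hlim : Filter.Tendsto (fun r : ℝ => ∫ z in Metric.ball 0 r, w z) (nhdsWithin 1 (Iio 1))
      (nhds (∫ z in Metric.ball 0 1, w z)) := by
    simp_rw [← integral_indicator (μ := (volume : Measure ℂ)) measurableSet_ball]
    refine tendsto_integral_filter_of_dominated_convergence
      (fun z => ‖(Metric.ball (0 : ℂ) 1).indicator w z‖) ?_ ?_
      (hi.integrable_indicator measurableSet_ball).norm ?_
    · filter_upwards [self_mem_nhdsWithin] with r hr
      exact ((hi.mono_set (Metric.ball_subset_ball (le_of_lt hr))).integrable_indicator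
        measurableSet_ball).aestronglyMeasurable
    · filter_upwards [self_mem_nhdsWithin] with r hr
      refine Filter.Eventually.of_forall fun z => ?_
      exact norm_indicator_le_of_subset (Metric.ball_subset_ball (le_of_lt hr)) w z
    · refine Filter.Eventually.of_forall fun z => ?_
      by_cases hz : z ∈ Metric.ball (0 : ℂ) 1
      · refine tendsto_const_nhds.congr' ?_
        rw [mem_ball_zero_iff] at hz
        filter_upwards [mem_nhdsWithin_of_mem_nhds (lt_mem_nhds hz)] with r hr
        rw [indicator_of_mem (by simpa using hz), indicator_of_mem (by simpa using hr)]
      · refine tendsto_const_nhds.congr' ?_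
        filter_upwards [self_mem_nhdsWithin] with r hr
        rw [indicator_of_notMem hz, indicator_of_notMem]
        exact fun h' => hz (Metric.ball_subset_ball (le_of_lt hr) h')
  have hev : ∀ᶠ r in nhdsWithin 1 (Iio 1), δ / 2 < ‖(∫ z in Metric.ball 0 r, w z) - J‖ :=
    ((hlim.sub_const J).norm).eventually (lt_mem_nhds (by linarith : δ / 2 < δ))
  obtain ⟨r₁, hr₁, hr₁'⟩ := (mem_nhdsLT_iff_exists_Ioo_subset' h1).1 hev
  set r₂ := max r₀ r₁ with hr₂
  have hr₂0 : 0 < r₂ := lt_max_of_lt_left h0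
  have hr₂1 : r₂ < 1 := max_lt h1 hr₁
  have hVi : IntegrableOn (fun s : ℝ => s * V s) (Ioo 0 1) := by
    have := (integrableOn_polar hc hi).norm
    rw [Measure.volume_eq_prod, ← Measure.prod_restrict] at this
    have := this.integral_prod_left
    refine (integrableOn_congr_fun (fun s hs => ?_) measurableSet_Ioo).1 this
    simp only [norm_mul, Complex.norm_real, Real.norm_of_nonneg (mem_Ioo.1 hs).1.le]
    rw [integral_const_mul, hV]
    simp only
    rw [intervalIntegral.integral_of_le (by linarith [Real.pi_pos]), integral_Ioc_eq_integral_Ioo]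
  -- From δ/2 < C(1 - s)V(s) one gets 1/(1 - s) ≤ (2C/δ)V(s); the factor s/r₂ ≥ 1 brings in the
  -- integrable function sV(s).
  have hbad : IntegrableOn (fun s : ℝ => (s - 1)⁻¹) (Ioo r₂ 1) := by
    have hVi' := (hVi.mono_set (Ioo_subset_Ioo_left hr₂0.le)).const_mul (2 * C / (δ * r₂))
    refine Integrable.mono hVi' ?_ ?_
    · exact (measurable_id.sub_const 1).inv.aestronglyMeasurable
    · refine (ae_restrict_iff' measurableSet_Ioo).2 (Filter.Eventually.of_forall fun s hs => ?_)
      have hs1 : 0 < 1 - s := by linarith [hs.2]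
      have hb := h s ⟨(le_max_left _ _).trans_lt hs.1, hs.2⟩
      have hb' : δ / 2 < ‖(∫ z in Metric.ball 0 s, w z) - J‖ :=
        hr₁' ⟨(le_max_right _ _).trans_lt hs.1, hs.2⟩
      have hVs : 0 ≤ V s := intervalIntegral.integral_nonneg (by linarith [Real.pi_pos])
        fun _ _ => norm_nonneg _
      have hCV : δ / 2 < C * (1 - s) * V s := hb'.trans_le hb
      have hC : 0 < C * V s := by
        by_contra! hcon
        have := mul_nonpos_of_nonneg_of_nonpos hs1.le hcon
        linarith
      rw [norm_inv, Real.norm_eq_abs, abs_sub_comm, abs_of_pos hs1]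
      refine le_trans ?_ (le_abs_self _)
      rw [inv_le_iff_one_le_mul₀ hs1]
      have e : 2 * C / (δ * r₂) * (s * V s) * (1 - s) =
          (s / r₂) * (C * (1 - s) * V s / (δ / 2)) := by field_simp
      rw [e]
      have g1 : 1 ≤ s / r₂ := (one_le_div hr₂0).2 hs.1.le
      have g2 : 1 ≤ C * (1 - s) * V s / (δ / 2) := (one_le_div (by linarith)).2 hCV.le
      nlinarith
  have : IntervalIntegrable (fun s : ℝ => (s - 1)⁻¹) volume r₂ 1 := by
    rw [intervalIntegrable_iff_integrableOn_Ioo_of_le hr₂1.le]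
    exact hbad
  rw [intervalIntegrable_sub_inv_iff] at this
  rcases this with h | h
  · exact hr₂1.ne h
  · exact h right_mem_uIcc

theorem one_add_mul_conj_ne_zero (w : ℂ) : 1 + w * conj w ≠ 0 := by
  rw [Complex.mul_conj]
  have := Complex.normSq_nonneg w
  norm_cast
  positivity

/-- The combination of partial derivatives is 2∂̄. Only conj F contributes, and t/(1 + Ft) has
t-derivative 1/(1 + Ft)². With A = HF' this is the primitive used in Green's theorem. -/
theorem hasFDerivAt_mul_conj_div {A F : ℂ → ℂ} {A' F' z : ℂ} (hA : HasDerivAt A A' z)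
    (hF : HasDerivAt F F' z) : ∃ g' : ℂ →L[ℝ] ℂ,
    HasFDerivAt (fun z => A z * conj (F z) * (1 + F z * conj (F z))⁻¹) g' z ∧
    g' 1 + Complex.I * g' Complex.I = 2 * (A z * conj F' / (1 + F z * conj (F z)) ^ 2) := by
  have hne := one_add_mul_conj_ne_zero (F z)
  have h1 := hA.complexToReal_fderiv
  have h2 := hF.complexToReal_fderiv
  have h3 := (Complex.conjCLE.toContinuousLinearMap.hasFDerivAt (x := F z)).comp z h2
  have h4 := (hasDerivAt_inv hne).complexToReal_fderiv.comp z ((h2.mul h3).const_add 1)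
  refine ⟨_, (h1.mul h3).mul h4, ?_⟩
  simp
  field_simp
  ring_nf
  simp only [Complex.I_sq]
  ring

/-- A quadrature identity on the unit disc for the pull-back of the spherical measure by `F`, where
`Fs` is a continuous substitute for `conj F` near the unit circle. -/
theorem setIntegral_ball_eq_of_circleIntegral {H F F' Fs : ℂ → ℂ} {r₀ C : ℝ} {J : ℂ}
    (hH : DifferentiableOn ℂ H (Metric.ball 0 1))
    (hF : ∀ z ∈ Metric.ball (0 : ℂ) 1, HasDerivAt F (F' z) z)
    (hF' : DifferentiableOn ℂ F' (Metric.ball 0 1))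
    (hFs : ContinuousOn Fs (Metric.ball 0 1)) (h0 : 0 < r₀) (h1 : r₀ < 1)
    (hne : ∀ z : ℂ, r₀ < ‖z‖ → ‖z‖ < 1 → 1 + F z * Fs z ≠ 0)
    (hb : ∀ z : ℂ, r₀ < ‖z‖ → ‖z‖ < 1 →
      ‖F' z * (conj (F z) - Fs z) / ((1 + F z * conj (F z)) * (1 + F z * Fs z))‖ ≤
        C * (1 - ‖z‖) * ‖F' z * conj (F' z) / (1 + F z * conj (F z)) ^ 2‖)
    (hcirc : ∀ r ∈ Ioo r₀ 1, ∮ z in C(0, r), H z * (F' z * Fs z / (1 + F z * Fs z)) =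
      2 * Real.pi * Complex.I * J)
    (hi : IntegrableOn (fun z => H z * (F' z * conj (F' z) / (1 + F z * conj (F z)) ^ 2))
      (Metric.ball 0 1)) :
    ∫ z in Metric.ball 0 1, H z * (F' z * conj (F' z) / (1 + F z * conj (F z)) ^ 2) =
      Real.pi * J := by
  have hHc := hH.continuousOn
  have hFc : ContinuousOn F (Metric.ball 0 1) := fun z hz => (hF z hz).continuousAt.continuousWithinAt
  have hF'c := hF'.continuousOn
  have hcF : ContinuousOn (fun z => conj (F z)) (Metric.ball 0 1) :=
    Complex.continuous_conj.comp_continuousOn hFc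
  have hcF' : ContinuousOn (fun z => conj (F' z)) (Metric.ball 0 1) :=
    Complex.continuous_conj.comp_continuousOn hF'c
  have hden : ContinuousOn (fun z => 1 + F z * conj (F z)) (Metric.ball 0 1) :=
    continuousOn_const.add (hFc.mul hcF)
  have hw : ContinuousOn (fun z => H z * (F' z * conj (F' z) / (1 + F z * conj (F z)) ^ 2))
      (Metric.ball 0 1) :=
    hHc.mul ((hF'c.mul hcF').div (hden.pow 2) fun z _ => pow_ne_zero 2 (one_add_mul_conj_ne_zero _))
  -- The half comes from the factor 1/(2i) in Green's theorem.
  refine setIntegral_ball_eq_of_bound (C := C / 2) hw hi h0 h1 fun r hr => ?_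
  have hr0 : 0 < r := h0.trans hr.1
  have hsub : Metric.closedBall (0 : ℂ) r ⊆ Metric.ball 0 1 := Metric.closedBall_subset_ball hr.2
  have hA : ∀ z ∈ Metric.ball (0 : ℂ) 1, HasDerivAt (fun z => H z * F' z)
      (deriv (fun z => H z * F' z) z) z :=
    fun z hz => ((hH.mul hF').differentiableAt (Metric.isOpen_ball.mem_nhds hz)).hasDerivAt
  choose! g' hg1 hg2 using fun z (hz : z ∈ Metric.ball (0 : ℂ) 1) =>
    hasFDerivAt_mul_conj_div (hA z hz) (hF z hz)
  have hgreen := circleIntegral_eq_setIntegral_ball hr0.le (fun z hz => hg1 z (hsub hz))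
    (fun z hz => hg2 z (hsub hz))
    ((((hHc.mul hF'c).mul hcF').div (hden.pow 2)
      fun z _ => pow_ne_zero 2 (one_add_mul_conj_ne_zero _)).mono hsub)
  have hsph : Metric.sphere (0 : ℂ) r ⊆ Metric.ball 0 1 := Metric.sphere_subset_closedBall.trans hsub
  have hsphn : ∀ z ∈ Metric.sphere (0 : ℂ) r, r₀ < ‖z‖ ∧ ‖z‖ < 1 := by
    intro z hz
    rw [mem_sphere_zero_iff_norm] at hz
    rw [hz]; exact hr
  have hden2 : ContinuousOn (fun z => 1 + F z * Fs z) (Metric.sphere (0 : ℂ) r) :=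
    (continuousOn_const.add (hFc.mul hFs)).mono hsph
  -- The error of replacing conj F by `Fs`: g/(1 + Fg) - s/(1 + Fs) = (g - s)/((1 + Fg)(1 + Fs)).
  set E : ℂ → ℂ := fun z =>
    H z * (F' z * (conj (F z) - Fs z) / ((1 + F z * conj (F z)) * (1 + F z * Fs z))) with hE
  have hEc : ContinuousOn E (Metric.sphere (0 : ℂ) r) :=
    (hHc.mono hsph).mul (((hF'c.mul (hcF.sub hFs)).mono hsph).div ((hden.mono hsph).mul hden2)
      fun z hz => mul_ne_zero (one_add_mul_conj_ne_zero _) (hne z (hsphn z hz).1 (hsphn z hz).2))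
  have hmc : ContinuousOn (fun z => H z * (F' z * Fs z / (1 + F z * Fs z)))
      (Metric.sphere (0 : ℂ) r) :=
    (hHc.mono hsph).mul (((hF'c.mul hFs).mono hsph).div hden2
      fun z hz => hne z (hsphn z hz).1 (hsphn z hz).2)
  have hsplit : ∮ z in C(0, r), H z * F' z * conj (F z) * (1 + F z * conj (F z))⁻¹ =
      (∮ z in C(0, r), E z) + 2 * Real.pi * Complex.I * J := by
    rw [← hcirc r hr, ← circleIntegral.integral_add (hEc.circleIntegrable hr0.le)
      (hmc.circleIntegrable hr0.le)]
    refine circleIntegral.integral_congr hr0.le fun z hz => ?_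
    have n1 := one_add_mul_conj_ne_zero (F z)
    have n2 := hne z (hsphn z hz).1 (hsphn z hz).2
    have key : ∀ h f f' g s : ℂ, 1 + f * g ≠ 0 → 1 + f * s ≠ 0 → h * f' * g * (1 + f * g)⁻¹ =
        h * (f' * (g - s) / ((1 + f * g) * (1 + f * s))) + h * (f' * s / (1 + f * s)) := by
      intro h f f' g s hg hs
      obtain ⟨u, hu⟩ : ∃ u, u = 1 + f * g := ⟨_, rfl⟩
      obtain ⟨v, hv⟩ : ∃ v, v = 1 + f * s := ⟨_, rfl⟩
      rw [← hu] at hg ⊢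
      rw [← hv] at hs ⊢
      field_simp
      rw [hu, hv]
      ring
    exact key _ _ _ _ _ n1 n2
  have hval : (∫ z in Metric.ball 0 r, H z * (F' z * conj (F' z) / (1 + F z * conj (F z)) ^ 2)) -
      Real.pi * J = (2 * Complex.I)⁻¹ * ∮ z in C(0, r), E z := by
    rw [hsplit] at hgreen
    have : (∫ z in Metric.ball 0 r, H z * (F' z * conj (F' z) / (1 + F z * conj (F z)) ^ 2)) =
        ∫ z in Metric.ball 0 r, H z * F' z * conj (F' z) / (1 + F z * conj (F z)) ^ 2 := by
      congr 1; ext z; ring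
    rw [this]
    have hI := Complex.I_ne_zero
    field_simp
    linear_combination -hgreen
  rw [hval, norm_mul, norm_inv, norm_mul, Complex.norm_I, Complex.norm_two, mul_one,
    circleIntegral_eq_integral_polarMap]
  have hpi : -Real.pi ≤ Real.pi := by linarith [Real.pi_pos]
  have hps : ∀ t : ℝ, polarMap (r, t) ∈ Metric.sphere (0 : ℂ) r := fun t => by
    rw [mem_sphere_zero_iff_norm, norm_polarMap, abs_of_pos hr0]
  have hpc : Continuous fun t : ℝ => polarMap (r, t) := continuous_polarMap.comp (by fun_prop)
  have hle : ‖∫ t in (-Real.pi)..Real.pi, Complex.I * polarMap (r, t) * E (polarMap (r, t))‖ ≤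
      ∫ t in (-Real.pi)..Real.pi, C * (1 - r) * ‖H (polarMap (r, t)) * (F' (polarMap (r, t)) *
        conj (F' (polarMap (r, t))) /
          (1 + F (polarMap (r, t)) * conj (F (polarMap (r, t)))) ^ 2)‖ := by
    refine intervalIntegral.norm_integral_le_of_norm_le hpi
      (Filter.Eventually.of_forall fun t _ => ?_) ?_
    · have hz := hsphn _ (hps t)
      have hn : ‖polarMap (r, t)‖ = r := mem_sphere_zero_iff_norm.1 (hps t)
      have := hb _ hz.1 hz.2
      rw [hn] at this
      simp only [hE]
      rw [norm_mul, norm_mul, Complex.norm_I, one_mul, hn, norm_mul, norm_mul (H _)]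
      calc r * (‖H (polarMap (r, t))‖ * _) ≤ 1 * (‖H (polarMap (r, t))‖ * _) :=
            mul_le_mul_of_nonneg_right hr.2.le (by positivity)
        _ ≤ _ := by
            rw [one_mul, mul_left_comm]
            exact mul_le_mul_of_nonneg_left this (norm_nonneg _)
    · refine ContinuousOn.intervalIntegrable ?_
      refine continuousOn_const.mul ?_
      exact ((hw.mono hsph).comp hpc.continuousOn fun t _ => hps t).norm
  rw [intervalIntegral.integral_const_mul] at hle
  linarith

/-! ### Transfer to the unit disc -/

/-- The Cayley transform from the unit disc to the upper half-plane. -/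
noncomputable def cayley (z : ℂ) : ℂ := Complex.I * (1 + z) / (1 - z)

theorem one_sub_ne_zero_of_mem_ball {z : ℂ} (hz : z ∈ Metric.ball (0 : ℂ) 1) : 1 - z ≠ 0 := by
  intro h
  rw [mem_ball_zero_iff, ← sub_eq_zero.1 h] at hz
  simp at hz

theorem one_add_ne_zero_of_mem_ball {z : ℂ} (hz : z ∈ Metric.ball (0 : ℂ) 1) : 1 + z ≠ 0 := by
  intro h
  rw [mem_ball_zero_iff, ← norm_neg, ← eq_neg_of_add_eq_zero_left h] at hz
  simp at hz

theorem hasDerivAt_cayley {z : ℂ} (hz : 1 - z ≠ 0) :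
    HasDerivAt cayley (2 * Complex.I / (1 - z) ^ 2) z := by
  have h := (((hasDerivAt_id z).const_add 1).const_mul Complex.I).div
    ((hasDerivAt_id z).const_sub 1) hz
  refine h.congr_deriv ?_
  simp only [id]
  ring

theorem cayley_bijOn : BijOn cayley (Metric.ball 0 1) upperHalf := by
  -- This formula settles both that the disc lands in the half-plane and that preimages of the
  -- half-plane lie in the disc.
  have him : ∀ z : ℂ, 1 - z ≠ 0 → (cayley z).im = (1 - ‖z‖ ^ 2) / ‖1 - z‖ ^ 2 := by
    intro z hz
    rw [← Complex.normSq_eq_norm_sq, ← Complex.normSq_eq_norm_sq, cayley, Complex.div_im]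
    have : Complex.normSq (1 - z) ≠ 0 := by simpa using hz
    field_simp
    simp [Complex.normSq_apply]
    ring
  refine ⟨fun z hz => ?_, fun z hz w hw h => ?_, fun ζ hζ => ?_⟩
  · have hz' := one_sub_ne_zero_of_mem_ball hz
    rw [mem_ball_zero_iff] at hz
    change 0 < (cayley z).im
    rw [him z hz']
    have : 0 < ‖1 - z‖ := norm_pos_iff.2 hz'
    have : 0 < 1 - ‖z‖ ^ 2 := by nlinarith [norm_nonneg z]
    positivity
  · have hz' := one_sub_ne_zero_of_mem_ball hz
    have hw' := one_sub_ne_zero_of_mem_ball hw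
    rw [cayley, cayley, div_eq_div_iff hz' hw'] at h
    have hI := Complex.I_ne_zero
    have : Complex.I * (2 * (z - w)) = 0 := by linear_combination h
    simpa [sub_eq_zero] using this
  · have hζ' : 0 < ζ.im := hζ
    have hne : ζ + Complex.I ≠ 0 := by
      intro h
      have := congrArg Complex.im h
      simp at this
      linarith
    have h1 : 1 - (ζ - Complex.I) / (ζ + Complex.I) ≠ 0 := by
      have : 1 - (ζ - Complex.I) / (ζ + Complex.I) = 2 * Complex.I / (ζ + Complex.I) := by
        field_simp; ring
      rw [this]
      exact div_ne_zero (by simp) hne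
    have h2 : cayley ((ζ - Complex.I) / (ζ + Complex.I)) = ζ := by
      rw [cayley, div_eq_iff h1]
      field_simp
      ring
    refine ⟨(ζ - Complex.I) / (ζ + Complex.I), ?_, h2⟩
    have h3 := him _ h1
    rw [h2] at h3
    rw [h3] at hζ'
    have h4 : 0 < ‖1 - (ζ - Complex.I) / (ζ + Complex.I)‖ ^ 2 := by positivity
    have h5 := (div_pos_iff_of_pos_right h4).1 hζ'
    rw [mem_ball_zero_iff]
    nlinarith [norm_nonneg ((ζ - Complex.I) / (ζ + Complex.I))]

theorem abs_det_restrictScalars_smul_one (c : ℂ) : |(c • (1 : ℂ →L[ℝ] ℂ)).det| = ‖c‖ ^ 2 := by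
  have : ((c • (1 : ℂ →L[ℝ] ℂ) : ℂ →L[ℝ] ℂ) : ℂ →ₗ[ℝ] ℂ) =
      (c • (LinearMap.id : ℂ →ₗ[ℂ] ℂ)).restrictScalars ℝ := by
    ext
    simp
  rw [ContinuousLinearMap.det, this, LinearMap.det_restrictScalars, LinearMap.det_smul]
  simp [Algebra.norm_complex_eq, Complex.normSq_eq_norm_sq]

/-- The derivative of `hypMap a b`. -/
noncomputable def hypMapDeriv (a b : ℝ) (ζ : ℂ) : ℂ :=
  (1 / 2) * (((a : ℂ) - Complex.I * b) - ((a : ℂ) + Complex.I * b) / ζ ^ 2)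

theorem hasDerivAt_hypMap (a b : ℝ) {ζ : ℂ} (hζ : ζ ≠ 0) :
    HasDerivAt (hypMap a b) (hypMapDeriv a b ζ) ζ := by
  have h := (((hasDerivAt_id ζ).const_mul ((a : ℂ) - Complex.I * b)).add
    ((hasDerivAt_inv hζ).const_mul ((a : ℂ) + Complex.I * b))).const_mul (1 / 2 : ℂ)
  refine h.congr_deriv ?_
  rw [hypMapDeriv]
  ring

theorem measurable_hypMap (a b : ℝ) : Measurable (hypMap a b) := by
  unfold hypMap
  fun_prop

theorem ne_zero_of_mem_upperHalf {ζ : ℂ} (hζ : ζ ∈ upperHalf) : ζ ≠ 0 := by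
  rintro rfl
  exact lt_irrefl (0 : ℝ) hζ

/-- The map `hypMap a b` in the coordinate of the unit disc. -/
noncomputable def hypDisc (a b : ℝ) (z : ℂ) : ℂ := hypMap a b (cayley z)

/-- The derivative of `hypDisc a b`. -/
noncomputable def hypDiscDeriv (a b : ℝ) (z : ℂ) : ℂ :=
  hypMapDeriv a b (cayley z) * (2 * Complex.I / (1 - z) ^ 2)

/-- The density of the spherical measure pulled back by `hypDisc a b`, up to the factor `π`. -/
noncomputable def discDensity (a b : ℝ) (z : ℂ) : ℂ :=
  hypDiscDeriv a b z * conj (hypDiscDeriv a b z) / (1 + hypDisc a b z * conj (hypDisc a b z)) ^ 2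

theorem cayley_ne_zero {z : ℂ} (hz : z ∈ Metric.ball (0 : ℂ) 1) : cayley z ≠ 0 :=
  ne_zero_of_mem_upperHalf (cayley_bijOn.mapsTo hz)

theorem hasDerivAt_hypDisc (a b : ℝ) {z : ℂ} (hz : z ∈ Metric.ball (0 : ℂ) 1) :
    HasDerivAt (hypDisc a b) (hypDiscDeriv a b z) z :=
  (hasDerivAt_hypMap a b (cayley_ne_zero hz)).comp z
    (hasDerivAt_cayley (one_sub_ne_zero_of_mem_ball hz))

theorem sphericalDensity_comp_cayley (a b : ℝ) (h : ℂ → ℂ) {z : ℂ}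
    (hz : z ∈ Metric.ball (0 : ℂ) 1) :
    |((2 * Complex.I / (1 - z) ^ 2) • (1 : ℂ →L[ℝ] ℂ)).det| • ((ENNReal.ofReal
      (‖deriv (hypMap a b) (cayley z)‖ ^ 2 / (Real.pi * (1 + ‖hypMap a b (cayley z)‖ ^ 2) ^ 2))).toReal
        • h (cayley z)) = (Real.pi : ℂ)⁻¹ * (h (cayley z) * discDensity a b z) := by
  rw [abs_det_restrictScalars_smul_one, ENNReal.toReal_ofReal (by positivity),
    (hasDerivAt_hypMap a b (cayley_ne_zero hz)).deriv, discDensity, Complex.mul_conj',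
    Complex.mul_conj', hypDiscDeriv, norm_mul, ← hypDisc, Complex.real_smul, Complex.real_smul]
  push_cast
  have h1 : (1 + (‖hypDisc a b z‖ : ℂ) ^ 2) ≠ 0 := by
    rw [← Complex.mul_conj']
    exact one_add_mul_conj_ne_zero _
  have h2 : (Real.pi : ℂ) ≠ 0 := by exact_mod_cast Real.pi_ne_zero
  field_simp

theorem integral_sphericalPullback_hypMap (a b : ℝ) (h : ℂ → ℂ) :
    (∫ ζ, h ζ ∂(sphericalPullback (hypMap a b) upperHalf) =
      (Real.pi : ℂ)⁻¹ * ∫ z in Metric.ball 0 1, h (cayley z) * discDensity a b z) ∧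
    (Integrable h (sphericalPullback (hypMap a b) upperHalf) →
      IntegrableOn (fun z => h (cayley z) * discDensity a b z) (Metric.ball 0 1)) := by
  have hmeas : Measurable fun ζ => ENNReal.ofReal
      (‖deriv (hypMap a b) ζ‖ ^ 2 / (Real.pi * (1 + ‖hypMap a b ζ‖ ^ 2) ^ 2)) := by
    have h1 := measurable_deriv (hypMap a b)
    have h2 := measurable_hypMap a b
    fun_prop
  have hfin : ∀ᵐ ζ ∂(volume.restrict upperHalf), ENNReal.ofReal
      (‖deriv (hypMap a b) ζ‖ ^ 2 / (Real.pi * (1 + ‖hypMap a b ζ‖ ^ 2) ^ 2)) < ⊤ :=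
    Filter.Eventually.of_forall fun _ => ENNReal.ofReal_lt_top
  have hder : ∀ z ∈ Metric.ball (0 : ℂ) 1, HasFDerivWithinAt cayley
      ((2 * Complex.I / (1 - z) ^ 2) • (1 : ℂ →L[ℝ] ℂ)) (Metric.ball 0 1) z := fun z hz =>
    (hasDerivAt_cayley (one_sub_ne_zero_of_mem_ball hz)).complexToReal_fderiv.hasFDerivWithinAt
  constructor
  · rw [sphericalPullback, integral_withDensity_eq_integral_toReal_smul hmeas hfin,
      ← cayley_bijOn.image_eq, integral_image_eq_integral_abs_det_fderiv_smul _ measurableSet_ball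
        hder cayley_bijOn.injOn, ← integral_const_mul]
    exact setIntegral_congr_fun measurableSet_ball fun z hz => sphericalDensity_comp_cayley a b h hz
  · intro hi
    rw [sphericalPullback, integrable_withDensity_iff_integrable_smul' hmeas hfin,
      ← cayley_bijOn.image_eq] at hi
    have hi' := (integrableOn_image_iff_integrableOn_abs_det_fderiv_smul _ measurableSet_ball
        hder cayley_bijOn.injOn _).1 hi
    have hi'' := (hi'.congr_fun (fun z hz => sphericalDensity_comp_cayley a b h hz)
      measurableSet_ball).const_mul (Real.pi : ℂ)
    have h2 : (Real.pi : ℂ) ≠ 0 := by exact_mod_cast Real.pi_ne_zero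
    refine IntegrableOn.congr_fun hi'' (fun z _ => ?_) measurableSet_ball
    exact mul_inv_cancel_left₀ h2 _

/-! ### The error estimate near the unit circle -/

/-- The reflection of `hypMap a b`, in the coordinate of the unit disc. -/
noncomputable def hypDiscRefl (a b : ℝ) (z : ℂ) : ℂ := reflected (hypMap a b) (cayley z)

/-- The numerator of `hypDiscDeriv a b`. -/
noncomputable def derivNum (a b : ℝ) (z : ℂ) : ℂ :=
  ((a : ℂ) - Complex.I * b) * (Complex.I * (1 + z)) ^ 2 - ((a : ℂ) + Complex.I * b) * (1 - z) ^ 2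

/-- The numerator of `hypDisc a b`. -/
noncomputable def mapNum (a b : ℝ) (z : ℂ) : ℂ := (1 / 2) *
  (((a : ℂ) - Complex.I * b) * (Complex.I * (1 + z)) ^ 2 + ((a : ℂ) + Complex.I * b) * (1 - z) ^ 2)

/-- The numerator of `hypDiscRefl a b`. -/
noncomputable def reflNum (a b : ℝ) (z : ℂ) : ℂ := (1 / 2) *
  (((a : ℂ) + Complex.I * b) * (Complex.I * (1 + z)) ^ 2 + ((a : ℂ) - Complex.I * b) * (1 - z) ^ 2)

/-- The numerator of `1 + hypDisc a b z * hypDiscRefl a b z`. -/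
noncomputable def polarityNum (a b : ℝ) (z : ℂ) : ℂ :=
  (Complex.I * (1 + z) * (1 - z)) ^ 2 + mapNum a b z * reflNum a b z

/-- The numerator of `1 + hypDisc a b z * conj (hypDisc a b z)`. -/
noncomputable def sphericalNum (a b : ℝ) (z : ℂ) : ℂ :=
  (Complex.I * (1 + z) * (1 - z)) * conj (Complex.I * (1 + z) * (1 - z)) +
    mapNum a b z * conj (mapNum a b z)

/-- The cofactor of `1 - |z|²` in the numerator of `conj (hypDisc a b z) - hypDiscRefl a b z`. -/
noncomputable def diffNum (a b : ℝ) (z : ℂ) : ℂ :=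
  ((a : ℂ) + Complex.I * b) * ((1 + z) * conj (1 + z)) -
    ((a : ℂ) - Complex.I * b) * ((1 - z) * conj (1 - z))

theorem hypDisc_eq (a b : ℝ) {z : ℂ} (hz : z ∈ Metric.ball (0 : ℂ) 1) :
    hypDisc a b z = mapNum a b z / (Complex.I * (1 + z) * (1 - z)) := by
  have h1 := one_sub_ne_zero_of_mem_ball hz
  have h2 := one_add_ne_zero_of_mem_ball hz
  have hI := Complex.I_ne_zero
  rw [hypDisc, hypMap, cayley, mapNum]
  field_simp

theorem hypDiscRefl_eq (a b : ℝ) {z : ℂ} (hz : z ∈ Metric.ball (0 : ℂ) 1) :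
    hypDiscRefl a b z = reflNum a b z / (Complex.I * (1 + z) * (1 - z)) := by
  have h1 := one_sub_ne_zero_of_mem_ball hz
  have h2 := one_add_ne_zero_of_mem_ball hz
  have hI := Complex.I_ne_zero
  rw [hypDiscRefl, reflected_hypMap, cayley, reflNum]
  field_simp

theorem hypDiscDeriv_eq (a b : ℝ) {z : ℂ} (hz : z ∈ Metric.ball (0 : ℂ) 1) :
    hypDiscDeriv a b z = Complex.I * derivNum a b z / (Complex.I * (1 + z) * (1 - z)) ^ 2 := by
  have h1 := one_sub_ne_zero_of_mem_ball hz
  have h2 := one_add_ne_zero_of_mem_ball hz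
  have hI := Complex.I_ne_zero
  rw [hypDiscDeriv, hypMapDeriv, cayley, derivNum]
  field_simp

/-- The reflection agrees with the conjugate on the unit circle away from the poles ±1, which
accounts for the factor 1 - |z|². It supplies the decay of the error. -/
theorem conj_hypDisc_sub_hypDiscRefl (a b : ℝ) {z : ℂ} (hz : z ∈ Metric.ball (0 : ℂ) 1) :
    conj (hypDisc a b z) - hypDiscRefl a b z = -Complex.I * (1 - z * conj z) * diffNum a b z /
      ((Complex.I * (1 + z) * (1 - z)) * conj (Complex.I * (1 + z) * (1 - z))) := by
  have h1 := one_sub_ne_zero_of_mem_ball hz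
  have h2 := one_add_ne_zero_of_mem_ball hz
  have hI := Complex.I_ne_zero
  have h1' : 1 - conj z ≠ 0 := by simpa using (map_ne_zero (starRingEnd ℂ)).2 h1
  have h2' : 1 + conj z ≠ 0 := by simpa using (map_ne_zero (starRingEnd ℂ)).2 h2
  rw [hypDisc_eq a b hz, hypDiscRefl_eq a b hz, mapNum, reflNum, diffNum]
  simp only [map_div₀, map_mul, map_add, map_sub, map_one, map_pow, map_ofNat, Complex.conj_I,
    Complex.conj_ofReal]
  field_simp
  ring_nf
  simp only [Complex.I_sq, show Complex.I ^ 3 = -Complex.I from Complex.I_pow_three]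
  ring

theorem one_add_hypDisc_mul_conj (a b : ℝ) {z : ℂ} (hz : z ∈ Metric.ball (0 : ℂ) 1) :
    1 + hypDisc a b z * conj (hypDisc a b z) = sphericalNum a b z /
      ((Complex.I * (1 + z) * (1 - z)) * conj (Complex.I * (1 + z) * (1 - z))) := by
  have h1 : Complex.I * (1 + z) * (1 - z) ≠ 0 := mul_ne_zero (mul_ne_zero Complex.I_ne_zero
    (one_add_ne_zero_of_mem_ball hz)) (one_sub_ne_zero_of_mem_ball hz)
  have h2 := (map_ne_zero (starRingEnd ℂ)).2 h1
  rw [hypDisc_eq a b hz, sphericalNum, map_div₀, eq_div_iff (mul_ne_zero h1 h2)]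
  generalize Complex.I * (1 + z) * (1 - z) = K at *
  generalize conj K = K' at *
  field_simp

theorem one_add_hypDisc_mul_hypDiscRefl (a b : ℝ) {z : ℂ} (hz : z ∈ Metric.ball (0 : ℂ) 1) :
    1 + hypDisc a b z * hypDiscRefl a b z =
      polarityNum a b z / (Complex.I * (1 + z) * (1 - z)) ^ 2 := by
  have h1 : Complex.I * (1 + z) * (1 - z) ≠ 0 := mul_ne_zero (mul_ne_zero Complex.I_ne_zero
    (one_add_ne_zero_of_mem_ball hz)) (one_sub_ne_zero_of_mem_ball hz)
  rw [hypDisc_eq a b hz, hypDiscRefl_eq a b hz, polarityNum, eq_div_iff (pow_ne_zero 2 h1)]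
  generalize Complex.I * (1 + z) * (1 - z) = K at *
  field_simp

/-- All powers of i(1 + z)(1 - z) and of its conjugate cancel. The comparison of error and density
thus involves only functions continuous on the closed disc, including the poles z = ±1. -/
theorem discError_mul_eq (a b : ℝ) {z : ℂ} (hz : z ∈ Metric.ball (0 : ℂ) 1)
    (hQ : polarityNum a b z ≠ 0) :
    hypDiscDeriv a b z * (conj (hypDisc a b z) - hypDiscRefl a b z) /
      ((1 + hypDisc a b z * conj (hypDisc a b z)) * (1 + hypDisc a b z * hypDiscRefl a b z)) *
      (polarityNum a b z * conj (derivNum a b z)) =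
    (1 - z * conj z) * (sphericalNum a b z * diffNum a b z) * discDensity a b z := by
  have h1 : Complex.I * (1 + z) * (1 - z) ≠ 0 := mul_ne_zero (mul_ne_zero Complex.I_ne_zero
    (one_add_ne_zero_of_mem_ball hz)) (one_sub_ne_zero_of_mem_ball hz)
  have h2 := (map_ne_zero (starRingEnd ℂ)).2 h1
  have hD : sphericalNum a b z ≠ 0 := by
    intro h
    have := one_add_hypDisc_mul_conj a b hz
    rw [h, zero_div] at this
    exact one_add_mul_conj_ne_zero _ this
  rw [discDensity, one_add_hypDisc_mul_conj a b hz, one_add_hypDisc_mul_hypDiscRefl a b hz,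
    conj_hypDisc_sub_hypDiscRefl a b hz, hypDiscDeriv_eq a b hz, map_div₀, map_pow,
    map_mul (starRingEnd ℂ) Complex.I (derivNum a b z), Complex.conj_I]
  generalize Complex.I * (1 + z) * (1 - z) = K at *
  generalize conj K = K' at *
  field_simp

/-- On the boundary 1 + ff* = 1 + |f|² > 0 and f' ≠ 0, and the cleared numerators survive at the
poles. With x = Re z, the relation z + 1/z = 2x makes both numerators explicit: z² times a positive
number, and -4z(ax - ib). -/
theorem derivNum_mul_polarityNum_ne_zero {a b : ℝ} (ha : 0 < a) (hb : 0 < b) {z : ℂ}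
    (hz : ‖z‖ = 1) : polarityNum a b z * conj (derivNum a b z) ≠ 0 := by
  have hzz : z * conj z = 1 := by rw [Complex.mul_conj', hz]; norm_num
  have h0 : z ≠ 0 := by rintro rfl; simp at hz
  have hre : z + conj z = 2 * (z.re : ℂ) := by rw [Complex.add_conj]; push_cast; ring
  set x := z.re with hx
  have hx1 : x ^ 2 ≤ 1 := by
    have := Complex.abs_re_le_norm z
    rw [hz] at this
    exact (sq_le_one_iff_abs_le_one _).2 this
  have e1 : (1 + z) ^ 2 = z * (2 + 2 * x) := by rw [← hre]; linear_combination -hzz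
  have e2 : (1 - z) ^ 2 = z * (2 * x - 2) := by rw [← hre]; linear_combination -hzz
  have hL : derivNum a b z = -z * (4 * a * x - 4 * b * Complex.I) := by
    rw [derivNum, mul_pow, Complex.I_sq, e1, e2]; ring
  have hQ : polarityNum a b z = z ^ 2 * ((4 * (1 - x ^ 2) + 4 * (a ^ 2 + b ^ 2 * x ^ 2) : ℝ) : ℂ) := by
    rw [polarityNum, mapNum, reflNum]
    simp only [mul_pow, e1, e2]
    simp only [Complex.I_sq]
    push_cast
    ring_nf
    simp only [Complex.I_sq]
    ring
  refine mul_ne_zero ?_ ((map_ne_zero _).2 ?_)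
  · rw [hQ]
    refine mul_ne_zero (pow_ne_zero 2 h0) ?_
    have : 0 < 4 * (1 - x ^ 2) + 4 * (a ^ 2 + b ^ 2 * x ^ 2) := by
      have : 0 < a ^ 2 := by positivity
      have : 0 ≤ b ^ 2 * x ^ 2 := by positivity
      linarith
    exact_mod_cast this.ne'
  · rw [hL]
    refine mul_ne_zero (neg_ne_zero.2 h0) fun h => ?_
    have := congrArg Complex.im h
    simp at this
    exact hb.ne' this

theorem exists_lt_norm_of_ne_zero_on_sphere {q : ℂ → ℂ} (hq : Continuous q)
    (h : ∀ z : ℂ, ‖z‖ = 1 → q z ≠ 0) :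
    ∃ r₀ k : ℝ, 0 < r₀ ∧ r₀ < 1 ∧ 0 < k ∧ ∀ z : ℂ, r₀ < ‖z‖ → ‖z‖ < 1 → k < ‖q z‖ := by
  have hK : IsCompact (Metric.sphere (0 : ℂ) 1) := isCompact_sphere 0 1
  obtain ⟨z₀, hz₀, hmin⟩ := hK.exists_isMinOn ⟨1, by simp⟩ hq.norm.continuousOn
  have hk : 0 < ‖q z₀‖ := norm_pos_iff.2 (h z₀ (mem_sphere_zero_iff_norm.1 hz₀))
  obtain ⟨δ, hδ, hsub⟩ := hK.exists_thickening_subset_open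
    (isOpen_lt continuous_const hq.norm : IsOpen {z | ‖q z₀‖ / 2 < ‖q z‖})
    (fun z hz => (half_lt_self hk).trans_le (hmin hz))
  refine ⟨max (1 - δ) (1 / 2), ‖q z₀‖ / 2, lt_max_of_lt_right (by norm_num),
    max_lt (by linarith) (by norm_num), by positivity, fun z hz hz1 => hsub ?_⟩
  have hz0 : 0 < ‖z‖ := (lt_max_of_lt_right (by norm_num : (0 : ℝ) < 1 / 2)).trans hz
  have hzδ : 1 - δ < ‖z‖ := (le_max_left _ _).trans_lt hz
  have hne : (‖z‖ : ℂ) ≠ 0 := by exact_mod_cast hz0.ne'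
  -- The radial projection to the circle moves z by exactly 1 - |z| < δ.
  refine Metric.mem_thickening_iff.2 ⟨z / ‖z‖, ?_, ?_⟩
  · rw [mem_sphere_zero_iff_norm, norm_div, Complex.norm_real, norm_norm, div_self hz0.ne']
  · rw [dist_eq_norm]
    have : z - z / ‖z‖ = -(z / ‖z‖ * ((1 - ‖z‖ : ℝ) : ℂ)) := by
      push_cast; field_simp; ring
    rw [this, norm_neg, norm_mul, norm_div, Complex.norm_real, norm_norm, div_self hz0.ne', one_mul,
      Complex.norm_real, Real.norm_of_nonneg (by linarith)]
    linarith

theorem exists_discError_bound {a b : ℝ} (ha : 0 < a) (hb : 0 < b) :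
    ∃ r₀ C : ℝ, 0 < r₀ ∧ r₀ < 1 ∧ ∀ z : ℂ, r₀ < ‖z‖ → ‖z‖ < 1 →
      1 + hypDisc a b z * hypDiscRefl a b z ≠ 0 ∧
      ‖hypDiscDeriv a b z * (conj (hypDisc a b z) - hypDiscRefl a b z) /
        ((1 + hypDisc a b z * conj (hypDisc a b z)) * (1 + hypDisc a b z * hypDiscRefl a b z))‖ ≤
        C * (1 - ‖z‖) * ‖discDensity a b z‖ := by
  have hc1 : Continuous fun z => polarityNum a b z * conj (derivNum a b z) := by
    unfold polarityNum derivNum mapNum reflNum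
    fun_prop
  have hc2 : Continuous fun z => sphericalNum a b z * diffNum a b z := by
    unfold sphericalNum diffNum mapNum
    fun_prop
  obtain ⟨r₀, k, h0, h1, hk, hbd⟩ := exists_lt_norm_of_ne_zero_on_sphere hc1
    fun z hz => derivNum_mul_polarityNum_ne_zero ha hb hz
  obtain ⟨B, hB⟩ := (isCompact_closedBall (0 : ℂ) 1).exists_bound_of_continuousOn hc2.continuousOn
  -- B bounds the cofactor above, k bounds the nonvanishing factor below, and 1 - |z|² ≤ 2(1 - |z|)
  -- gives the 2.
  refine ⟨r₀, 2 * B / k, h0, h1, fun z hz hz1 => ?_⟩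
  have hzb : z ∈ Metric.ball (0 : ℂ) 1 := mem_ball_zero_iff.2 hz1
  have hkz := hbd z hz hz1
  have hQ : polarityNum a b z ≠ 0 := by
    intro h
    rw [h, zero_mul, norm_zero] at hkz
    exact hkz.not_gt hk
  refine ⟨?_, ?_⟩
  · rw [one_add_hypDisc_mul_hypDiscRefl a b hzb]
    exact div_ne_zero hQ (pow_ne_zero 2 (mul_ne_zero (mul_ne_zero Complex.I_ne_zero
      (one_add_ne_zero_of_mem_ball hzb)) (one_sub_ne_zero_of_mem_ball hzb)))
  · have key := congrArg norm (discError_mul_eq a b hzb hQ)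
    have hBz := hB z (Metric.ball_subset_closedBall hzb)
    have hn : ‖1 - z * conj z‖ = 1 - ‖z‖ ^ 2 := by
      rw [Complex.mul_conj']
      rw [show (1 : ℂ) - (‖z‖ : ℂ) ^ 2 = ((1 - ‖z‖ ^ 2 : ℝ) : ℂ) by push_cast; ring,
        Complex.norm_real, Real.norm_of_nonneg (by nlinarith [norm_nonneg z])]
    rw [norm_mul, norm_mul ((1 - z * conj z) * _), norm_mul (1 - z * conj z), hn] at key
    set X := ‖hypDiscDeriv a b z * (conj (hypDisc a b z) - hypDiscRefl a b z) /
        ((1 + hypDisc a b z * conj (hypDisc a b z)) * (1 + hypDisc a b z * hypDiscRefl a b z))‖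
    have hX : 0 ≤ X := norm_nonneg _
    have hB0 : 0 ≤ B := (norm_nonneg _).trans hBz
    have step : X * k ≤ 2 * (1 - ‖z‖) * B * ‖discDensity a b z‖ := by
      calc X * k ≤ X * ‖polarityNum a b z * conj (derivNum a b z)‖ :=
            mul_le_mul_of_nonneg_left hkz.le hX
        _ = _ := key
        _ ≤ _ := by
            refine mul_le_mul_of_nonneg_right ?_ (norm_nonneg _)
            refine mul_le_mul ?_ hBz (norm_nonneg _) (by linarith)
            nlinarith [norm_nonneg z]
    rw [← le_div_iff₀ hk] at step
    refine step.trans (le_of_eq ?_)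
    ring

theorem integral_sphericalPullback_eq_of_circleIntegral {a b : ℝ} (ha : 0 < a) (hb : 0 < b)
    {h : ℂ → ℂ} (hd : DifferentiableOn ℂ h upperHalf)
    (hi : Integrable h (sphericalPullback (hypMap a b) upperHalf)) {ρ : ℝ} (hρ : ρ < 1) {J : ℂ}
    (hcirc : ∀ r ∈ Ioo ρ 1, 0 < r → ∮ z in C(0, r), h (cayley z) * (hypDiscDeriv a b z *
      hypDiscRefl a b z / (1 + hypDisc a b z * hypDiscRefl a b z)) = 2 * Real.pi * Complex.I * J) :
    ∫ ζ, h ζ ∂(sphericalPullback (hypMap a b) upperHalf) = J := by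
  obtain ⟨r₀, C, h0, h1, hbd⟩ := exists_discError_bound ha hb
  obtain ⟨hint, hin⟩ := integral_sphericalPullback_hypMap a b h
  have hpi : (Real.pi : ℂ) ≠ 0 := by exact_mod_cast Real.pi_ne_zero
  have hcd : DifferentiableOn ℂ cayley (Metric.ball 0 1) := fun z hz =>
    (hasDerivAt_cayley (one_sub_ne_zero_of_mem_ball hz)).differentiableAt.differentiableWithinAt
  have hF' : DifferentiableOn ℂ (hypDiscDeriv a b) (Metric.ball 0 1) := by
    intro z hz
    have h1 := pow_ne_zero 2 (cayley_ne_zero hz)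
    have h2 := pow_ne_zero 2 (one_sub_ne_zero_of_mem_ball hz)
    have h3 := hcd z hz
    unfold hypDiscDeriv hypMapDeriv
    fun_prop (disch := assumption)
  have hFs : ContinuousOn (hypDiscRefl a b) (Metric.ball 0 1) := by
    intro z hz
    have h1 := cayley_ne_zero hz
    have h3 := (hcd z hz).continuousWithinAt
    have : hypDiscRefl a b = fun z => (1 / 2) * (((a : ℂ) + Complex.I * b) * cayley z +
        ((a : ℂ) - Complex.I * b) * (cayley z)⁻¹) := by
      ext z; exact reflected_hypMap a b _
    rw [this]
    fun_prop (disch := assumption)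
  rw [hint]
  have key := setIntegral_ball_eq_of_circleIntegral (H := fun z => h (cayley z))
    (F := hypDisc a b) (F' := hypDiscDeriv a b) (Fs := hypDiscRefl a b) (r₀ := max r₀ ρ) (C := C)
    (J := J) (hd.comp hcd cayley_bijOn.mapsTo) (fun z hz => hasDerivAt_hypDisc a b hz) hF' hFs
    (lt_max_of_lt_left h0) (max_lt h1 hρ)
    (fun z hz hz1 => (hbd z ((le_max_left _ _).trans_lt hz) hz1).1)
    (fun z hz hz1 => (hbd z ((le_max_left _ _).trans_lt hz) hz1).2)
    (fun r hr => hcirc r ⟨(le_max_right _ _).trans_lt hr.1, hr.2⟩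
      (h0.trans ((le_max_left _ _).trans_lt hr.1)))
    (hin hi)
  have e : ∫ z in Metric.ball 0 1, h (cayley z) * discDensity a b z = Real.pi * J := key
  rw [e, inv_mul_cancel_left₀ hpi]

/-! ### Residues at the nodes -/

/-- The zeros are z = p and z = 1/p; the latter corresponds to -`cayley p` and lies outside the
disc. -/
theorem cayley_sq_sub_sq {z p : ℂ} (hz : 1 - z ≠ 0) (hp : 1 - p ≠ 0) :
    cayley z ^ 2 - cayley p ^ 2 = -4 * (z - p) * (1 - z * p) / ((1 - z) ^ 2 * (1 - p) ^ 2) := by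
  rw [cayley, cayley]
  field_simp
  rw [Complex.I_sq]
  ring

theorem one_sub_mul_ne_zero {z p : ℂ} (hz : ‖z‖ < 1) (hp : ‖p‖ < 1) : 1 - z * p ≠ 0 := by
  intro h
  have := congrArg norm (sub_eq_zero.1 h)
  rw [norm_one, norm_mul] at this
  nlinarith [norm_nonneg z, norm_nonneg p]

theorem circleIntegral_mul_cayley_kernel {H : ℂ → ℂ} (hH : DifferentiableOn ℂ H (Metric.ball 0 1))
    {p : ℂ} {r : ℝ} (hp : ‖p‖ < r) (hr : r < 1) :
    ∮ z in C(0, r), H z * (cayley z * (2 * Complex.I / (1 - z) ^ 2) /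
      (cayley z ^ 2 - cayley p ^ 2)) = Real.pi * Complex.I * H p := by
  have hr0 : 0 ≤ r := (norm_nonneg p).trans hp.le
  have hp1 : 1 - p ≠ 0 := one_sub_ne_zero_of_mem_ball (mem_ball_zero_iff.2 (hp.trans hr))
  have hp2 : 1 + p ≠ 0 := one_add_ne_zero_of_mem_ball (mem_ball_zero_iff.2 (hp.trans hr))
  have hsub : Metric.closedBall (0 : ℂ) r ⊆ Metric.ball 0 1 := Metric.closedBall_subset_ball hr
  -- G is the integrand times z - p. Its value H(p)/2 reflects the residue 1/2 of ζ/(ζ² - u) at a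
  -- square root of u.
  set G : ℂ → ℂ := fun z => H z * ((1 + z) * (1 - p) ^ 2 / (2 * ((1 - z) * (1 - z * p)))) with hG
  have hGd : DifferentiableOn ℂ G (Metric.closedBall 0 r) := by
    intro z hz
    have h1 := one_sub_ne_zero_of_mem_ball (hsub hz)
    have h2 := one_sub_mul_ne_zero (mem_ball_zero_iff.1 (hsub hz)) (hp.trans hr)
    have h3 : 2 * ((1 - z) * (1 - z * p)) ≠ 0 := by simp [h1, h2]
    have h4 := hH.mono hsub z hz
    fun_prop (disch := assumption)
  have hC := hGd.circleIntegral_sub_inv_smul (w := p) (mem_ball_zero_iff.2 hp)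
  have hGp : G p = H p / 2 := by
    have : 1 - p * p ≠ 0 := one_sub_mul_ne_zero (hp.trans hr) (hp.trans hr)
    simp only [hG]
    have e : (1 + p) * (1 - p) ^ 2 / (2 * ((1 - p) * (1 - p * p))) = 1 / 2 := by
      rw [show 1 - p * p = (1 - p) * (1 + p) by ring]
      field_simp
    rw [e]; ring
  rw [hGp] at hC
  rw [show Real.pi * Complex.I * H p = (2 * Real.pi * Complex.I) • (H p / 2) by
    rw [smul_eq_mul]; ring, ← hC]
  refine circleIntegral.integral_congr hr0 fun z hz => ?_
  have hz' := hsub (Metric.sphere_subset_closedBall hz)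
  have h1 := one_sub_ne_zero_of_mem_ball hz'
  have h2 := one_sub_mul_ne_zero (mem_ball_zero_iff.1 hz') (hp.trans hr)
  have h3 : z - p ≠ 0 := by
    intro h
    rw [sub_eq_zero.1 h, mem_sphere_zero_iff_norm] at hz
    exact hp.ne hz
  simp only [hG, smul_eq_mul]
  rw [cayley_sq_sub_sq h1 hp1, cayley]
  field_simp
  rw [Complex.I_sq]
  ring

theorem circleIntegral_mul_cayley_double_kernel {H : ℂ → ℂ}
    (hH : DifferentiableOn ℂ H (Metric.ball 0 1)) {r : ℝ} (hr0 : 0 < r) (hr : r < 1) :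
    ∮ z in C(0, r), H z * (cayley z * (2 * Complex.I / (1 - z) ^ 2) /
      (cayley z ^ 2 - cayley 0 ^ 2) ^ 2) = -(Real.pi * Complex.I / 4) * deriv H 0 := by
  have hsub : Metric.closedBall (0 : ℂ) r ⊆ Metric.ball 0 1 := Metric.closedBall_subset_ball hr
  have hH0 : DifferentiableAt ℂ H 0 :=
    hH.differentiableAt (Metric.isOpen_ball.mem_nhds (by simp))
  -- For p = 0 the squared denominator is 16z²/(1 - z)⁴ and the whole kernel is -(1 - z²)/(8z²), so
  -- Cauchy's formula for the derivative applies.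
  have hC := Complex.two_pi_I_inv_smul_circleIntegral_sub_sq_inv_smul_of_differentiable
    Metric.isOpen_ball hsub (f := fun z => H z * (-(1 - z ^ 2) / 8))
    (hH.mul (by fun_prop)) (Metric.mem_ball_self hr0)
  have hder : deriv (fun z => H z * (-(1 - z ^ 2) / 8)) 0 = -deriv H 0 / 8 := by
    have h1 : HasDerivAt (fun z : ℂ => -(1 - z ^ 2) / 8) 0 0 := by
      refine ((((hasDerivAt_pow 2 (0 : ℂ)).const_sub 1).neg).div_const 8).congr_deriv ?_
      simp
    have h2 : HasDerivAt (fun z => H z * (-(1 - z ^ 2) / 8)) _ 0 := hH0.hasDerivAt.mul h1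
    rw [h2.deriv]
    simp
    ring
  have hpi : (Real.pi : ℂ) ≠ 0 := by exact_mod_cast Real.pi_ne_zero
  rw [hder, smul_eq_mul, inv_mul_eq_iff_eq_mul₀ (by simp [hpi])] at hC
  rw [show -(Real.pi * Complex.I / 4) * deriv H 0 =
    2 * Real.pi * Complex.I * (-deriv H 0 / 8) by ring, ← hC]
  refine circleIntegral.integral_congr hr0.le fun z hz => ?_
  have h1 := one_sub_ne_zero_of_mem_ball (hsub (Metric.sphere_subset_closedBall hz))
  have h3 : z ≠ 0 := by
    rintro rfl
    rw [mem_sphere_zero_iff_norm, norm_zero] at hz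
    exact hr0.ne hz
  simp only [smul_eq_mul]
  rw [cayley_sq_sub_sq h1 (by simp), cayley]
  simp only [sub_zero, mul_zero, one_pow, mul_one]
  field_simp
  rw [Complex.I_sq]
  ring

theorem circleIntegral_mul_cayley_log_deriv {H : ℂ → ℂ}
    (hH : DifferentiableOn ℂ H (Metric.ball 0 1)) {r : ℝ} (hr0 : 0 ≤ r) (hr : r < 1) :
    ∮ z in C(0, r), H z * ((cayley z)⁻¹ * (2 * Complex.I / (1 - z) ^ 2)) = 0 := by
  have hsub : Metric.closedBall (0 : ℂ) r ⊆ Metric.ball 0 1 := Metric.closedBall_subset_ball hr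
  have hd : DifferentiableOn ℂ (fun z => H z * ((cayley z)⁻¹ * (2 * Complex.I / (1 - z) ^ 2)))
      (Metric.closedBall 0 r) := by
    intro z hz
    have h1 := one_sub_ne_zero_of_mem_ball (hsub hz)
    have h2 := pow_ne_zero 2 h1
    have h3 := cayley_ne_zero (hsub hz)
    have h4 := hH.mono hsub z hz
    have h5 : DifferentiableWithinAt ℂ cayley (Metric.closedBall 0 r) z :=
      (hasDerivAt_cayley h1).differentiableAt.differentiableWithinAt
    fun_prop (disch := assumption)
  exact (hd.diffContOnCl_ball (Subset.refl _)).circleIntegral_eq_zero hr0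

theorem hypNode_sq_mul_sq {a : ℝ} (b : ℝ) (ha : 0 < a) :
    hypNode₁ a b ^ 2 * hypNode₂ a b ^ 2 = 1 := by
  have h := focal_sq_ne_zero b ha
  have e1 := hypNode₁_sq b ha
  have e2 := hypNode₂_sq b ha
  have : (((a : ℂ) ^ 2 + (b : ℂ) ^ 2) * ((a : ℂ) ^ 2 + (b : ℂ) ^ 2)) *
      (hypNode₁ a b ^ 2 * hypNode₂ a b ^ 2) =
      (((a : ℂ) ^ 2 + (b : ℂ) ^ 2) * ((a : ℂ) ^ 2 + (b : ℂ) ^ 2)) * 1 := by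
    rw [mul_mul_mul_comm, e1, e2]
    linear_combination -4 * hypRoot_sq a b
  exact mul_left_cancel₀ (mul_ne_zero h h) this

/-- The first three terms are half the logarithmic derivative of 1 + ff*; the last comes from the
antisymmetric part (f'f* - f(f*)')/2. Since the squared nodes have product 1, the ζ⁴ - 1 in the
numerator is ζ⁴ minus that product. The last term is left unsplit so that it also covers a double
node. -/
theorem hypMapDeriv_mul_reflected_div {a : ℝ} (b : ℝ) (ha : 0 < a) {ζ : ℂ} (hζ : ζ ≠ 0)
    (h1 : ζ ^ 2 - hypNode₁ a b ^ 2 ≠ 0) (h2 : ζ ^ 2 - hypNode₂ a b ^ 2 ≠ 0) :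
    hypMapDeriv a b ζ * reflected (hypMap a b) ζ /
      (1 + hypMap a b ζ * reflected (hypMap a b) ζ) =
    -ζ⁻¹ + ζ / (ζ ^ 2 - hypNode₁ a b ^ 2) + ζ / (ζ ^ 2 - hypNode₂ a b ^ 2) -
      4 * Complex.I * a * b / ((a : ℂ) ^ 2 + (b : ℂ) ^ 2) *
        (ζ / ((ζ ^ 2 - hypNode₁ a b ^ 2) * (ζ ^ 2 - hypNode₂ a b ^ 2))) := by
  have h := focal_sq_ne_zero b ha
  have huv := hypNode_sq_mul_sq b ha
  have hnum : hypMapDeriv a b ζ * reflected (hypMap a b) ζ = (((a : ℂ) ^ 2 + (b : ℂ) ^ 2) *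
      (ζ ^ 4 - 1) - 4 * Complex.I * a * b * ζ ^ 2) / (4 * ζ ^ 3) := by
    rw [hypMapDeriv, reflected_hypMap]
    field_simp
    ring_nf
    rw [Complex.I_sq]
    ring
  rw [one_add_hypMap_mul_reflected b ha hζ, hnum, ← huv]
  have hu : hypNode₁ a b ^ 2 = ζ ^ 2 - (ζ ^ 2 - hypNode₁ a b ^ 2) := by ring
  have hv : hypNode₂ a b ^ 2 = ζ ^ 2 - (ζ ^ 2 - hypNode₂ a b ^ 2) := by ring
  generalize ζ ^ 2 - hypNode₁ a b ^ 2 = d at *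
  generalize ζ ^ 2 - hypNode₂ a b ^ 2 = e at *
  rw [hu, hv]
  generalize (a : ℂ) ^ 2 + (b : ℂ) ^ 2 = c at *
  field_simp
  ring

theorem hypDisc_kernel_eq {a : ℝ} (b : ℝ) (ha : 0 < a) {z : ℂ} (hz : z ∈ Metric.ball (0 : ℂ) 1)
    (h1 : cayley z ^ 2 - hypNode₁ a b ^ 2 ≠ 0) (h2 : cayley z ^ 2 - hypNode₂ a b ^ 2 ≠ 0) :
    hypDiscDeriv a b z * hypDiscRefl a b z / (1 + hypDisc a b z * hypDiscRefl a b z) =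
    -((cayley z)⁻¹ * (2 * Complex.I / (1 - z) ^ 2)) +
      cayley z * (2 * Complex.I / (1 - z) ^ 2) / (cayley z ^ 2 - hypNode₁ a b ^ 2) +
      cayley z * (2 * Complex.I / (1 - z) ^ 2) / (cayley z ^ 2 - hypNode₂ a b ^ 2) -
      4 * Complex.I * a * b / ((a : ℂ) ^ 2 + (b : ℂ) ^ 2) *
        (cayley z * (2 * Complex.I / (1 - z) ^ 2) /
          ((cayley z ^ 2 - hypNode₁ a b ^ 2) * (cayley z ^ 2 - hypNode₂ a b ^ 2))) := by
  have key := hypMapDeriv_mul_reflected_div b ha (cayley_ne_zero hz) h1 h2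
  rw [hypDiscDeriv, hypDisc, hypDiscRefl, mul_right_comm, mul_div_right_comm, key]
  ring

theorem circleIntegral_neg_add_add_sub {f₀ f₁ f₂ f₃ : ℂ → ℂ} {r : ℝ} (hr : 0 ≤ r) (c : ℂ)
    (h₀ : ContinuousOn f₀ (Metric.sphere 0 r)) (h₁ : ContinuousOn f₁ (Metric.sphere 0 r))
    (h₂ : ContinuousOn f₂ (Metric.sphere 0 r)) (h₃ : ContinuousOn f₃ (Metric.sphere 0 r)) :
    ∮ z in C(0, r), (-f₀ z + f₁ z + f₂ z - c * f₃ z) =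
      -(∮ z in C(0, r), f₀ z) + (∮ z in C(0, r), f₁ z) +
        (∮ z in C(0, r), f₂ z) - c * ∮ z in C(0, r), f₃ z := by
  have i₀ : CircleIntegrable (fun z => -f₀ z) 0 r := h₀.neg.circleIntegrable hr
  have i₁ := h₁.circleIntegrable hr
  have i₂ := h₂.circleIntegrable hr
  have i₃ : CircleIntegrable (fun z => c * f₃ z) 0 r :=
    (continuousOn_const.mul h₃).circleIntegrable hr
  have i₀₁ : CircleIntegrable (fun z => -f₀ z + f₁ z) 0 r := i₀.add i₁
  have i₀₂ : CircleIntegrable (fun z => -f₀ z + f₁ z + f₂ z) 0 r := i₀₁.add i₂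
  rw [circleIntegral.integral_sub i₀₂ i₃, circleIntegral.integral_add i₀₁ i₂,
    circleIntegral.integral_add i₀ i₁, circleIntegral.integral_const_mul]
  congr 3
  simp_rw [← neg_one_mul (f₀ _)]
  rw [circleIntegral.integral_const_mul, neg_one_mul]

theorem cayley_sq_sub_sq_ne_zero {p z : ℂ} {r : ℝ} (hp : ‖p‖ < r) (hr : r < 1)
    (hz : z ∈ Metric.sphere (0 : ℂ) r) : cayley z ^ 2 - cayley p ^ 2 ≠ 0 := by
  have hz1 : z ∈ Metric.ball (0 : ℂ) 1 :=
    Metric.closedBall_subset_ball hr (Metric.sphere_subset_closedBall hz)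
  have hp1 : p ∈ Metric.ball (0 : ℂ) 1 := mem_ball_zero_iff.2 (hp.trans hr)
  have h1 := one_sub_ne_zero_of_mem_ball hz1
  have h2 := one_sub_ne_zero_of_mem_ball hp1
  have h3 := one_sub_mul_ne_zero (mem_ball_zero_iff.1 hz1) (mem_ball_zero_iff.1 hp1)
  have h4 : z - p ≠ 0 := by
    intro h
    rw [sub_eq_zero.1 h, mem_sphere_zero_iff_norm] at hz
    exact hp.ne hz
  rw [cayley_sq_sub_sq h1 h2]
  exact div_ne_zero (mul_ne_zero (mul_ne_zero (by norm_num) h4) h3)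
    (mul_ne_zero (pow_ne_zero 2 h1) (pow_ne_zero 2 h2))

theorem continuousOn_cayley_sphere {r : ℝ} (hr : r < 1) :
    ContinuousOn cayley (Metric.sphere 0 r) ∧
      ContinuousOn (fun z : ℂ => 2 * Complex.I / (1 - z) ^ 2) (Metric.sphere 0 r) := by
  have h : ∀ z ∈ Metric.sphere (0 : ℂ) r, 1 - z ≠ 0 := fun z hz => one_sub_ne_zero_of_mem_ball
    (Metric.closedBall_subset_ball hr (Metric.sphere_subset_closedBall hz))
  exact ⟨fun z hz => (hasDerivAt_cayley (h z hz)).continuousAt.continuousWithinAt,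
    continuousOn_const.div (by fun_prop) fun z hz => pow_ne_zero 2 (h z hz)⟩

theorem continuousOn_mul_cayley_kernel {H : ℂ → ℂ} {p : ℂ} {r : ℝ}
    (hH : ContinuousOn H (Metric.sphere 0 r)) (hp : ‖p‖ < r) (hr : r < 1) :
    ContinuousOn (fun z => H z * (cayley z * (2 * Complex.I / (1 - z) ^ 2) /
      (cayley z ^ 2 - cayley p ^ 2))) (Metric.sphere 0 r) :=
  hH.mul (((continuousOn_cayley_sphere hr).1.mul (continuousOn_cayley_sphere hr).2).div
    (((continuousOn_cayley_sphere hr).1.pow 2).sub continuousOn_const)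
    fun _ hz => cayley_sq_sub_sq_ne_zero hp hr hz)

theorem circleIntegral_hypDisc_kernel {a : ℝ} (b : ℝ) (ha : 0 < a) {H : ℂ → ℂ}
    (hH : DifferentiableOn ℂ H (Metric.ball 0 1)) {p₁ p₂ : ℂ} (hp₁ : cayley p₁ = hypNode₁ a b)
    (hp₂ : cayley p₂ = hypNode₂ a b) {r : ℝ} (hr₁ : ‖p₁‖ < r) (hr₂ : ‖p₂‖ < r) (hr : r < 1) :
    ∮ z in C(0, r), H z * (hypDiscDeriv a b z * hypDiscRefl a b z /
      (1 + hypDisc a b z * hypDiscRefl a b z)) =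
    Real.pi * Complex.I * H p₁ + Real.pi * Complex.I * H p₂ -
      4 * Complex.I * a * b / ((a : ℂ) ^ 2 + (b : ℂ) ^ 2) *
        ∮ z in C(0, r), H z * (cayley z * (2 * Complex.I / (1 - z) ^ 2) /
          ((cayley z ^ 2 - cayley p₁ ^ 2) * (cayley z ^ 2 - cayley p₂ ^ 2))) := by
  have hr0 : 0 ≤ r := (norm_nonneg _).trans hr₁.le
  have hsph : Metric.sphere (0 : ℂ) r ⊆ Metric.ball 0 1 :=
    Metric.sphere_subset_closedBall.trans (Metric.closedBall_subset_ball hr)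
  have hHc := hH.continuousOn.mono hsph
  obtain ⟨hφ, hφ'⟩ := continuousOn_cayley_sphere hr
  have hq : ∀ p : ℂ, ContinuousOn (fun z => cayley z ^ 2 - cayley p ^ 2) (Metric.sphere 0 r) :=
    fun p => (hφ.pow 2).sub continuousOn_const
  rw [← circleIntegral_mul_cayley_kernel hH hr₁ hr, ← circleIntegral_mul_cayley_kernel hH hr₂ hr]
  have hsum := circleIntegral_neg_add_add_sub hr0
    (4 * Complex.I * a * b / ((a : ℂ) ^ 2 + (b : ℂ) ^ 2))
    (f₀ := fun z => H z * ((cayley z)⁻¹ * (2 * Complex.I / (1 - z) ^ 2)))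
    (f₃ := fun z => H z * (cayley z * (2 * Complex.I / (1 - z) ^ 2) /
      ((cayley z ^ 2 - cayley p₁ ^ 2) * (cayley z ^ 2 - cayley p₂ ^ 2))))
    (hHc.mul ((hφ.inv₀ fun z hz => cayley_ne_zero (hsph hz)).mul hφ'))
    (continuousOn_mul_cayley_kernel hHc hr₁ hr) (continuousOn_mul_cayley_kernel hHc hr₂ hr)
    (hHc.mul ((hφ.mul hφ').div ((hq p₁).mul (hq p₂)) fun z hz =>
      mul_ne_zero (cayley_sq_sub_sq_ne_zero hr₁ hr hz) (cayley_sq_sub_sq_ne_zero hr₂ hr hz)))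
  rw [circleIntegral_mul_cayley_log_deriv hH hr0 hr, neg_zero, zero_add] at hsum
  rw [← hsum]
  refine circleIntegral.integral_congr hr0 fun z hz => ?_
  have h1 := cayley_sq_sub_sq_ne_zero hr₁ hr hz
  have h2 := cayley_sq_sub_sq_ne_zero hr₂ hr hz
  rw [hp₁] at h1 ⊢
  rw [hp₂] at h2 ⊢
  rw [hypDisc_kernel_eq b ha (hsph hz) h1 h2]
  ring

/-- For u ≠ v, 1/((ζ² - u)(ζ² - v)) is the difference of the two simple kernels divided by u - v. -/
theorem circleIntegral_two_node_kernel {H : ℂ → ℂ} (hH : DifferentiableOn ℂ H (Metric.ball 0 1))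
    {p₁ p₂ : ℂ} {r : ℝ} (hr₁ : ‖p₁‖ < r) (hr₂ : ‖p₂‖ < r) (hr : r < 1)
    (hne : cayley p₁ ^ 2 - cayley p₂ ^ 2 ≠ 0) :
    ∮ z in C(0, r), H z * (cayley z * (2 * Complex.I / (1 - z) ^ 2) /
      ((cayley z ^ 2 - cayley p₁ ^ 2) * (cayley z ^ 2 - cayley p₂ ^ 2))) =
    (cayley p₁ ^ 2 - cayley p₂ ^ 2)⁻¹ * (Real.pi * Complex.I * H p₁ - Real.pi * Complex.I * H p₂) := by
  have hr0 : 0 ≤ r := (norm_nonneg _).trans hr₁.le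
  have hsph : Metric.sphere (0 : ℂ) r ⊆ Metric.ball 0 1 :=
    Metric.sphere_subset_closedBall.trans (Metric.closedBall_subset_ball hr)
  have hHc := hH.continuousOn.mono hsph
  rw [← circleIntegral_mul_cayley_kernel hH hr₁ hr, ← circleIntegral_mul_cayley_kernel hH hr₂ hr,
    ← circleIntegral.integral_sub
      ((continuousOn_mul_cayley_kernel hHc hr₁ hr).circleIntegrable hr0)
      ((continuousOn_mul_cayley_kernel hHc hr₂ hr).circleIntegrable hr0),
    ← circleIntegral.integral_const_mul]
  refine circleIntegral.integral_congr hr0 fun z hz => ?_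
  have h1 := cayley_sq_sub_sq_ne_zero hr₁ hr hz
  have h2 := cayley_sq_sub_sq_ne_zero hr₂ hr hz
  generalize 2 * Complex.I / (1 - z) ^ 2 = w
  generalize cayley z = ζ at *
  generalize cayley p₁ ^ 2 = u at *
  generalize cayley p₂ ^ 2 = v at *
  field_simp
  ring

theorem exists_cayley_eq {ζ : ℂ} (hζ : 0 < ζ.im) : ∃ p : ℂ, ‖p‖ < 1 ∧ cayley p = ζ := by
  obtain ⟨p, hp, h⟩ := cayley_bijOn.surjOn (show ζ ∈ upperHalf from hζ)
  exact ⟨p, mem_ball_zero_iff.1 hp, h⟩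

theorem differentiableOn_comp_cayley {h : ℂ → ℂ} (hd : DifferentiableOn ℂ h upperHalf) :
    DifferentiableOn ℂ (fun z => h (cayley z)) (Metric.ball 0 1) :=
  hd.comp (fun _ hz => (hasDerivAt_cayley
    (one_sub_ne_zero_of_mem_ball hz)).differentiableAt.differentiableWithinAt) cayley_bijOn.mapsTo

/-! ### The quadrature identities -/

/-- The two-node quadrature identity. -/
theorem integral_sphericalPullback_hypMap_of_hypRoot_ne_zero {a b : ℝ} (ha : 0 < a) (hb : 0 < b)
    (hR : hypRoot a b ≠ 0) {h : ℂ → ℂ} (hd : DifferentiableOn ℂ h upperHalf)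
    (hi : Integrable h (sphericalPullback (hypMap a b) upperHalf)) :
    ∫ ζ, h ζ ∂(sphericalPullback (hypMap a b) upperHalf) =
      (1 / 2) * (h (hypNode₁ a b) + h (hypNode₂ a b)) -
        (1 / 2) * (Complex.I * a * b / hypRoot a b) * (h (hypNode₁ a b) - h (hypNode₂ a b)) := by
  obtain ⟨i₁, i₂⟩ := hypNode_im_pos ha hb
  obtain ⟨p₁, hp₁, e₁⟩ := exists_cayley_eq i₁
  obtain ⟨p₂, hp₂, e₂⟩ := exists_cayley_eq i₂
  have hc := focal_sq_ne_zero b ha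
  -- Dividing the coefficient 4iab/c² by this difference gives iab over the inner root, the weight
  -- in the formula.
  have huv : hypNode₁ a b ^ 2 - hypNode₂ a b ^ 2 =
      4 * hypRoot a b / ((a : ℂ) ^ 2 + (b : ℂ) ^ 2) := by
    rw [eq_div_iff hc]
    linear_combination hypNode₁_sq b ha - hypNode₂_sq b ha
  have hne : cayley p₁ ^ 2 - cayley p₂ ^ 2 ≠ 0 := by
    rw [e₁, e₂, huv]
    exact div_ne_zero (mul_ne_zero (by norm_num) hR) hc
  have hH := differentiableOn_comp_cayley hd
  refine integral_sphericalPullback_eq_of_circleIntegral ha hb hd hi (max_lt hp₁ hp₂)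
    fun r hr _ => ?_
  have hr₁ := (le_max_left _ _).trans_lt hr.1
  have hr₂ := (le_max_right _ _).trans_lt hr.1
  rw [circleIntegral_hypDisc_kernel b ha hH e₁ e₂ hr₁ hr₂ hr.2,
    circleIntegral_two_node_kernel hH hr₁ hr₂ hr.2 hne, e₁, e₂, huv]
  field_simp

/-- The quadrature identity in the case of a double node. -/
theorem integral_sphericalPullback_hypMap_one {a : ℝ} (ha : 0 < a) {h : ℂ → ℂ}
    (hd : DifferentiableOn ℂ h upperHalf)
    (hi : Integrable h (sphericalPullback (hypMap a 1) upperHalf)) :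
    ∫ ζ, h ζ ∂(sphericalPullback (hypMap a 1) upperHalf) =
      h Complex.I - (a / (1 + a ^ 2)) * deriv h Complex.I := by
  obtain ⟨n₁, n₂⟩ := hypNode_eq_I ha
  have e : cayley 0 = Complex.I := by simp [cayley]
  have hc := focal_sq_ne_zero 1 ha
  have hH := differentiableOn_comp_cayley hd
  have hdI : DifferentiableAt ℂ h (cayley 0) := by
    rw [e]
    exact hd.differentiableAt ((isOpen_lt continuous_const Complex.continuous_im).mem_nhds (by simp))
  have hder : deriv (fun z => h (cayley z)) 0 = deriv h Complex.I * (2 * Complex.I) := by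
    have h1 : HasDerivAt (fun z => h (cayley z)) _ 0 :=
      hdI.hasDerivAt.comp 0 (hasDerivAt_cayley (by simp))
    rw [h1.deriv, e]
    simp
  -- The double node i is the image of the centre of the disc, so every circle of radius 0 < r < 1
  -- encloses it.
  refine integral_sphericalPullback_eq_of_circleIntegral ha one_pos hd hi (ρ := 0) one_pos
    fun r hr hr0 => ?_
  rw [circleIntegral_hypDisc_kernel 1 ha hH (p₁ := 0) (p₂ := 0) (e.trans n₁.symm) (e.trans n₂.symm)
    (by simpa using hr0) (by simpa using hr0) hr.2]
  simp_rw [← sq (cayley _ ^ 2 - cayley 0 ^ 2)]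
  rw [circleIntegral_mul_cayley_double_kernel hH hr0 hr.2, hder, e]
  have hc' : (a : ℂ) ^ 2 + ((1 : ℝ) : ℂ) ^ 2 = 1 + (a : ℂ) ^ 2 := by push_cast; ring
  rw [hc'] at hc ⊢
  push_cast
  field_simp
  ring_nf
  simp only [Complex.I_sq]
  ring

theorem mainTheorem3 (a b : ℝ) (ha : 0 < a) (hb : 0 < b) :
    -- `f` maps the boundary of the half-plane onto the hyperbola, and the half-plane onto
    -- the partly double-sheeted domain `2 · Ω₊ + 1 · Ω₀`
    BijOn (hypMap a b) {ζ : ℂ | ζ.im = 0 ∧ ζ ≠ 0} (hyperbola a b) ∧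
    (∀ w ∉ hyperbola a b,
      sheetNumber (hypMap a b) upperHalf w =
        2 * (hyperbolaRight a b).indicator 1 w + 1 * (hyperbolaMid a b).indicator 1 w) ∧
    -- the nodes are the roots of `1 + f f^* = 0` in the upper half-plane
    {ζ | ζ ∈ upperHalf ∧ 1 + hypMap a b ζ * reflected (hypMap a b) ζ = 0} =
      {hypNode₁ a b, hypNode₂ a b} ∧
    (b < 1 → (hypNode₁ a b).re = 0 ∧ (hypNode₂ a b).re = 0 ∧
      0 < (hypNode₁ a b).im ∧ (hypNode₁ a b).im < (hypNode₂ a b).im) ∧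
    (1 < b → 0 < (hypNode₁ a b).re ∧ 0 < (hypNode₁ a b).im ∧
      (hypNode₂ a b).re < 0 ∧ 0 < (hypNode₂ a b).im) ∧
    (b = 1 → hypNode₁ a b = Complex.I ∧ hypNode₂ a b = Complex.I ∧
      analyticOrderAt (fun ζ => 1 + hypMap a b ζ * reflected (hypMap a b) ζ) Complex.I = 2) ∧
    -- the quadrature identities
    ∀ h : ℂ → ℂ, DifferentiableOn ℂ h upperHalf →
      Integrable h (sphericalPullback (hypMap a b) upperHalf) →
      (b < 1 →
        ∫ ζ, h ζ ∂(sphericalPullback (hypMap a b) upperHalf) =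
          (1 / 2) * (h (hypNode₁ a b) + h (hypNode₂ a b)) -
            (1 / 2) * (Complex.I * a * b / (Real.sqrt ((1 + a ^ 2) * (1 - b ^ 2)) : ℂ)) *
              (h (hypNode₁ a b) - h (hypNode₂ a b))) ∧
      (1 < b →
        ∫ ζ, h ζ ∂(sphericalPullback (hypMap a b) upperHalf) =
          (1 / 2) * (h (hypNode₁ a b) + h (hypNode₂ a b)) -
            (1 / 2) * (a * b / (Real.sqrt ((a ^ 2 + 1) * (b ^ 2 - 1)) : ℂ)) *
              (h (hypNode₁ a b) - h (hypNode₂ a b))) ∧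
      (b = 1 →
        ∫ ζ, h ζ ∂(sphericalPullback (hypMap a b) upperHalf) =
          h Complex.I - (a / (1 + a ^ 2)) * deriv h Complex.I) := by
  refine ⟨hypMap_bijOn a b ha hb, fun w hw => sheetNumber_hypMap_upperHalf ha hb hw,
    roots_one_add_hypMap_mul_reflected ha hb, fun h => ?_, hypNode_of_one_lt ha, ?_,
    fun h hd hi => ⟨fun h1 => ?_, fun h1 => ?_, ?_⟩⟩
  · obtain ⟨h1, h2, h3, -, h4⟩ := hypNode_of_lt_one ha hb h.le
    exact ⟨h1, h2, h3, h4 h⟩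
  · rintro rfl
    exact ⟨(hypNode_eq_I ha).1, (hypNode_eq_I ha).2,
      analyticOrderAt_one_add_hypMap_mul_reflected ha⟩
  · have hR := hypRoot_of_le (a := a) hb h1.le
    have hpos : 0 < Real.sqrt ((1 + a ^ 2) * (1 - b ^ 2)) :=
      Real.sqrt_pos.2 (mul_pos (by positivity) (by nlinarith))
    rw [← hR]
    refine integral_sphericalPullback_hypMap_of_hypRoot_ne_zero ha hb ?_ hd hi
    rw [hR]
    exact_mod_cast hpos.ne'
  · have hR := hypRoot_of_lt (a := a) h1
    have hpos : 0 < Real.sqrt ((a ^ 2 + 1) * (b ^ 2 - 1)) :=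
      Real.sqrt_pos.2 (mul_pos (by positivity) (by nlinarith))
    have hne : (Real.sqrt ((a ^ 2 + 1) * (b ^ 2 - 1)) : ℂ) ≠ 0 := by exact_mod_cast hpos.ne'
    have hR0 : hypRoot a b ≠ 0 := by
      rw [hR]
      exact mul_ne_zero Complex.I_ne_zero hne
    -- For b > 1 the inner root is i times a positive real, and this i cancels the one in the
    -- weight.
    rw [integral_sphericalPullback_hypMap_of_hypRoot_ne_zero ha hb hR0 hd hi, hR, mul_assoc Complex.I,
      mul_div_mul_left _ _ Complex.I_ne_zero]
  · rintro rfl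
    exact integral_sphericalPullback_hypMap_one ha hd hi
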